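/- Let $A\in\mathbb{R}^{n\times n}$, $B\in\mathbb{R}^{n\times m}$ with $(A,B)$ stabilisable (there is $F$ with $A+BF$ Hurwitz). Let $U\subset\mathbb{R}^m$ and $\mathcal{E}_0=\{(x,u)\in\mathbb{R}^{n}\times\mathbb{R}^m : g(x,u)\le 0\}$, with $g\in\mathcal{C}^2(\mathbb{R}^n\times\mathbb{R}^m,\mathbb{R}^p)$ and $u\mapsto g_i(x,u)$ convex for all $i$ and $x$, be convex and compact and contain the origin in their interiors, and put $\mathcal{E}=\mathcal{E}_0\cap(\mathbb{R}^n\times U)$, $U(x)=\{u:(x,u)\in\mathcal{E}\}$, $X=\{x: U(x)\neq\emptyset\}$. Consider $\dot x=Ax+Bu$ with controls $u\in L^\infty_{\mathrm{loc}}(\mathbb{R}_{\ge0},\mathbb{R}^m)$ and the stage cost $$\ell(x,u)=(x^\top,u^\top)\begin{pmatrix}Q&S\\S^\top&R\end{pmatrix}\begin{pmatrix}x\\u\end{pmatrix}$$ with symmetric positive definite weighting matrix. For $T\in(0,\infty)$ let $\mathcal{U}_T(x_0)$ be the set of controls whose solution from $x_0$ satisfies $(x(t),u(t))\in\mathcal{E}$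 for all $t\in[0,T]$, define $\mathcal{U}_\infty(x_0)$ likewise with $[0,\infty)$, and for $T\in(0,\infty]$ let $V_T(x_0)=\inf_{u\in\mathcal{U}_T(x_0)}\int_0^T\ell(x(s),u(s))\,ds$ (with $\inf\emptyset=\infty$). Let $\ell^\star(x)=\inf_{u\in U(x)}\ell(x,u)$, let $V_T^{-1}[0,C]=\{x\in X: V_T(x)\le C\}$, and let $\mathcal{A}=\{x_0:\mathcal{U}_\infty(x_0)\ne\emptyset\}$ be the viability kernel. Consider the following conditions. (A1) There are class-$\mathcal{K}_\infty$ functions $\underline\eta,\overline\eta$ with $\underline\eta(|x|)\le\ell^\star(x)\le\overline\eta(|x|)$ on $X$. (A2) for $\gamma>0$ and a neighbourhood $\mathcal{N}$ of $0$: $V_\infty(x)\le\gamma\ell^\star(x)$ for all $x\in\mathcal{N}\cap X$. (A3) for $T>0$, $C>0$ and $\bar C>0$: $\delta'\ell^\star(x)\le\bar C V_{\delta'}(x)$ for all $\delta'\in(0,T]$ and $x\in V_T^{-1}[0,C]$. Put $M=\inf_{x\in X\setminus\mathcal{N}}\ell^\star(x)$ (with $\inf\emptyset=\infty$, $C/\infty=0$)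 and $\beta=\max\{C/M,\gamma\}$. The horizon condition for $N\ge1$ and $\delta>0$ is $$\max\Big\{\frac{C}{M\delta},\ \bar C\Big(\frac{\beta}{\delta}\Big)^2\Big\}\cdot\Big(\frac{\beta}{\beta+\delta}\Big)^{N-1}<1,$$ where $\delta<\beta$ or $N\ge2$. Theorem. Let $K\subset\mathrm{int}(\mathcal{A})$ be compact and $\delta>0$. Then (A1) holds, (A2) holds for some $\gamma$ and $\mathcal{N}$, (A3) holds for all $T,C>0$ with some $\bar C$, and $V_\infty$ is bounded on $K$. For all $C>0$ and all $\gamma,\mathcal{N}$ as in (A2), every sufficiently large $N$ satisfies the horizon condition with some $\bar C$ as in (A3) for $T=N\delta$ and $C$. Moreover, whenever $T=N\delta$, $C>0$, (A2) holds with $\gamma,\mathcal{N}$, (A3) holds with $\bar C$, $K\subseteq V_T^{-1}[0,C]$, and $N$ satisfies the horizon condition, the origin is asymptotically stable for the MPC closed loop with basin of attraction containing $K$. That is, let $\mu$ be any feedback that assigns to every $\hat x$ with $\mathcal{U}_T(\hat x)\ne\emptyset$ a minimiser $\mu(\hat x)$ of the optimal control problem with horizon $T$, and apply $u(t)=\mu(x(k\delta))(t-k\delta)$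 on $[k\delta,(k+1)\delta)$, $k=0,1,2,\dots$. Then the origin is Lyapunov stable, and from every initial value in a set that contains $K$ and a neighbourhood of the origin the closed loop exists for all times, all optimal control problems in the loop are feasible, the constraints hold for all $t\ge0$, and $x(t)\to0$. -/

import Mathlib

open Set Filter Topology MeasureTheory
open scoped NNReal ENNReal

noncomputable section

/-- A constrained continuous-time optimal control problem on `ℝⁿ × ℝᵐ`: right-hand side `f`, set `E`
of feasible state-control pairs and stage cost `ℓ`. The controlled equilibrium is the origin. -/
structure ControlProblem (n m : ℕ) where
  f : EuclideanSpace ℝ (Fin n) → EuclideanSpace ℝ (Fin m) → EuclideanSpace ℝ (Fin n)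
  E : Set (EuclideanSpace ℝ (Fin n) × EuclideanSpace ℝ (Fin m))
  ℓ : EuclideanSpace ℝ (Fin n) → EuclideanSpace ℝ (Fin m) → ℝ

/-- `u ∈ L^∞_loc(ℝ_{≥0}, ℝᵐ)`: Lebesgue measurable and locally essentially bounded on `[0,∞)`.
The values of `u` at negative times are irrelevant. -/
def IsControl {m : ℕ} (u : ℝ → EuclideanSpace ℝ (Fin m)) : Prop :=
  AEMeasurable u (volume.restrict (Ici 0)) ∧
    ∀ T : ℝ, ∃ c : ℝ, ∀ᵐ t ∂(volume.restrict (Icc 0 T)), ‖u t‖ ≤ c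

/-- Class `𝓚_∞`. -/
def IsClassKInf (η : ℝ≥0 → ℝ≥0) : Prop :=
  Continuous η ∧ StrictMono η ∧ η 0 = 0 ∧ Tendsto η atTop atTop

/-- All eigenvalues have negative real part. -/
def IsHurwitz {n : ℕ} (A : Matrix (Fin n) (Fin n) ℝ) : Prop :=
  ∀ z ∈ spectrum ℂ (A.map (algebraMap ℝ ℂ)), z.re < 0

/-- Stabilisability of the pair `(A, B)` by a linear state feedback. -/
def IsStabilisable {n m : ℕ} (A : Matrix (Fin n) (Fin n) ℝ) (B : Matrix (Fin n) (Fin m) ℝ) : Prop :=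
  ∃ F : Matrix (Fin m) (Fin n) ℝ, IsHurwitz (A + B * F)

namespace ControlProblem

variable {n m : ℕ} (P : ControlProblem n m)

/-- `x` is the (Carathéodory) solution of `ẋ = f(x,u)`, `x(0) = x₀`, on the time set `I`, which is
`[0,T]` or `[0,∞)`. -/
def IsSolution (I : Set ℝ) (x₀ : EuclideanSpace ℝ (Fin n)) (u : ℝ → EuclideanSpace ℝ (Fin m))
    (x : ℝ → EuclideanSpace ℝ (Fin n)) : Prop :=
  ContinuousOn x I ∧ ∀ t ∈ I, x t = x₀ + ∫ s in (0 : ℝ)..t, P.f (x s) (u s)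

/-- `u` is an admissible control function for the initial value `x₀` and the time set `I`, and `x` is
the corresponding solution. -/
def IsAdmissiblePair (I : Set ℝ) (x₀ : EuclideanSpace ℝ (Fin n)) (u : ℝ → EuclideanSpace ℝ (Fin m))
    (x : ℝ → EuclideanSpace ℝ (Fin n)) : Prop :=
  IsControl u ∧ P.IsSolution I x₀ u x ∧ ∀ t ∈ I, (x t, u t) ∈ P.E

/-- The set of admissible control functions: `𝒰_T(x₀)` for `I = [0,T]`, `𝒰_∞(x₀)` for
`I = [0,∞)`. -/
def admissible (I : Set ℝ) (x₀ : EuclideanSpace ℝ (Fin n)) : Set (ℝ → EuclideanSpace ℝ (Fin m)) :=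
  {u | ∃ x, P.IsAdmissiblePair I x₀ u x}

/-- The viability kernel. -/
def viabilityKernel : Set (EuclideanSpace ℝ (Fin n)) :=
  {x₀ | (P.admissible (Ici 0) x₀).Nonempty}

/-- The cost functional, along a control `u` and its trajectory `x`. -/
def cost (I : Set ℝ) (u : ℝ → EuclideanSpace ℝ (Fin m)) (x : ℝ → EuclideanSpace ℝ (Fin n)) : ℝ≥0∞ :=
  ∫⁻ s in I, ENNReal.ofReal (P.ℓ (x s) (u s))

/-- The infimum of the cost over all admissible controls; it is `∞` if there are none. -/
def value (I : Set ℝ) (x₀ : EuclideanSpace ℝ (Fin n)) : ℝ≥0∞ :=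
  ⨅ (u) (x) (_ : P.IsAdmissiblePair I x₀ u x), P.cost I u x

/-- The finite-horizon value function `V_T`. -/
def V (T : ℝ) (x₀ : EuclideanSpace ℝ (Fin n)) : ℝ≥0∞ := P.value (Icc 0 T) x₀

/-- The infinite-horizon value function `V_∞`. -/
def VInf (x₀ : EuclideanSpace ℝ (Fin n)) : ℝ≥0∞ := P.value (Ici 0) x₀

/-- `U(x)`. -/
def controlsAt (x : EuclideanSpace ℝ (Fin n)) : Set (EuclideanSpace ℝ (Fin m)) :=
  {u | (x, u) ∈ P.E}

/-- `X`, the projection of the constraint set to the state space. -/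
def stateSet : Set (EuclideanSpace ℝ (Fin n)) := {x | (P.controlsAt x).Nonempty}

/-- `ℓ⋆(x) = inf_{u ∈ U(x)} ℓ(x,u)`; only used for `x ∈ X` (and nonnegative `ℓ`). -/
def ellStar (x : EuclideanSpace ℝ (Fin n)) : ℝ := sInf (P.ℓ x '' P.controlsAt x)

/-- `V_T⁻¹[0,C]`. -/
def sublevel (T C : ℝ) : Set (EuclideanSpace ℝ (Fin n)) :=
  {x | x ∈ P.stateSet ∧ P.V T x ≤ ENNReal.ofReal C}

/-- Assumption (A1): `ℓ⋆` is enclosed by two class-`𝓚_∞` functions of `|x|` on `X`. -/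
def A1 : Prop :=
  ∃ η₁ η₂ : ℝ≥0 → ℝ≥0, IsClassKInf η₁ ∧ IsClassKInf η₂ ∧
    ∀ x ∈ P.stateSet, (η₁ ‖x‖₊ : ℝ) ≤ P.ellStar x ∧ P.ellStar x ≤ η₂ ‖x‖₊

/-- Assumption (A2), local cost controllability, with constant `γ` and neighbourhood `W` of the
origin. -/
def A2 (γ : ℝ) (W : Set (EuclideanSpace ℝ (Fin n))) : Prop :=
  0 < γ ∧ W ∈ 𝓝 0 ∧ ∀ x ∈ W ∩ P.stateSet, P.VInf x ≤ ENNReal.ofReal (γ * P.ellStar x)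

/-- Assumption (A3) for horizon `T` and level `C`, with constant `Cbar`. -/
def A3 (T C Cbar : ℝ) : Prop :=
  0 < Cbar ∧ ∀ δ ∈ Ioc 0 T, ∀ x ∈ P.sublevel T C,
    ENNReal.ofReal (δ * P.ellStar x) ≤ ENNReal.ofReal Cbar * P.V δ x

/-- `M = inf_{x ∈ X ∖ W} ℓ⋆(x)`, with `inf ∅ = ∞`. -/
def M (W : Set (EuclideanSpace ℝ (Fin n))) : ℝ≥0∞ :=
  ⨅ x ∈ P.stateSet \ W, ENNReal.ofReal (P.ellStar x)

/-- `C / M`, which is `0` if `M = ∞`. (Under (A1), `M > 0` for every neighbourhood `W` of `0`.) -/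
def ratio (C : ℝ) (W : Set (EuclideanSpace ℝ (Fin n))) : ℝ := (ENNReal.ofReal C / P.M W).toReal

/-- `β = max {C / M, γ}`. -/
def beta (C γ : ℝ) (W : Set (EuclideanSpace ℝ (Fin n))) : ℝ := max (P.ratio C W) γ

/-- The horizon condition
`max {C / (M δ), Cbar (β / δ)²} · (β / (β + δ))^(N - 1) < 1` for `N ≥ 1`. It is imposed for
`δ < β`; for `δ ≥ β` it is imposed with `N ≥ 2`. -/
def HorizonCondition (C γ : ℝ) (W : Set (EuclideanSpace ℝ (Fin n))) (Cbar δ : ℝ) (N : ℕ) : Prop :=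
  1 ≤ N ∧ (δ < P.beta C γ W ∨ 2 ≤ N) ∧
    max (P.ratio C W / δ) (Cbar * (P.beta C γ W / δ) ^ 2) *
      (P.beta C γ W / (P.beta C γ W + δ)) ^ (N - 1) < 1

/-- `u` is a minimiser of the optimal control problem with horizon `T` and initial value `x₀`. -/
def IsMinimiser (T : ℝ) (x₀ : EuclideanSpace ℝ (Fin n)) (u : ℝ → EuclideanSpace ℝ (Fin m)) : Prop :=
  ∃ x, P.IsAdmissiblePair (Icc 0 T) x₀ u x ∧ P.cost (Icc 0 T) u x = P.V T x₀

/-- `μ` is an MPC feedback with horizon `T`: it selects a minimiser `μ x` at every state `x` at which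
the optimal control problem is feasible. -/
def IsMPCFeedback (T : ℝ) (μ : EuclideanSpace ℝ (Fin n) → ℝ → EuclideanSpace ℝ (Fin m)) : Prop :=
  ∀ x, (P.admissible (Icc 0 T) x).Nonempty → P.IsMinimiser T x (μ x)

/-- `(u, x)` is a closed-loop control and trajectory from `x₀` under the sampled-data feedback `μ`
with sampling period `δ`: on `[kδ, (k+1)δ)` the control `μ (x (kδ))` is applied. -/
def IsClosedLoop (δ : ℝ) (μ : EuclideanSpace ℝ (Fin n) → ℝ → EuclideanSpace ℝ (Fin m))
    (x₀ : EuclideanSpace ℝ (Fin n)) (u : ℝ → EuclideanSpace ℝ (Fin m))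
    (x : ℝ → EuclideanSpace ℝ (Fin n)) : Prop :=
  IsControl u ∧ P.IsSolution (Ici 0) x₀ u x ∧
    ∀ k : ℕ, ∀ t ∈ Ico (k * δ) ((k + 1) * δ), u t = μ (x (k * δ)) (t - k * δ)

/-- The basin of attraction of the origin for the MPC closed loop: the initial values from which the
closed loop exists for all times, is recursively feasible, satisfies the constraints and converges to
the origin. -/
def basin (T δ : ℝ) (μ : EuclideanSpace ℝ (Fin n) → ℝ → EuclideanSpace ℝ (Fin m)) :
    Set (EuclideanSpace ℝ (Fin n)) :=
  {x₀ | (∃ u x, P.IsClosedLoop δ μ x₀ u x) ∧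
    ∀ u x, P.IsClosedLoop δ μ x₀ u x →
      (∀ k : ℕ, (P.admissible (Icc 0 T) (x (k * δ))).Nonempty) ∧
      (∀ t ∈ Ici (0 : ℝ), (x t, u t) ∈ P.E) ∧ Tendsto x atTop (𝓝 0)}

/-- The origin is asymptotically stable for the MPC closed loop: it is Lyapunov stable and its basin
of attraction is a neighbourhood of it. -/
def IsAsymptoticallyStable (T δ : ℝ)
    (μ : EuclideanSpace ℝ (Fin n) → ℝ → EuclideanSpace ℝ (Fin m)) : Prop :=
  (∀ ε > 0, ∃ ρ > 0, ∀ x₀ : EuclideanSpace ℝ (Fin n), ‖x₀‖ < ρ → ∀ u x,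
    P.IsClosedLoop δ μ x₀ u x → ∀ t ∈ Ici (0 : ℝ), ‖x t‖ < ε) ∧
  P.basin T δ μ ∈ 𝓝 0

end ControlProblem

/-- The set `{(x,u) : g(x,u) ≤ 0}` of mixed state-control constraints. -/
def mixedConstraintSet {n m p : ℕ}
    (g : Fin p → EuclideanSpace ℝ (Fin n) × EuclideanSpace ℝ (Fin m) → ℝ) :
    Set (EuclideanSpace ℝ (Fin n) × EuclideanSpace ℝ (Fin m)) :=
  {z | ∀ i, g i z ≤ 0}

/-- The linear-quadratic problem: `ẋ = A x + B u`, with the constraints `u(t) ∈ U` and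
`g(x(t),u(t)) ≤ 0`, and stage cost `(xᵀ, uᵀ) [Q, S; Sᵀ, R] (x; u)`. -/
def lqProblem {n m p : ℕ} (A : Matrix (Fin n) (Fin n) ℝ) (B : Matrix (Fin n) (Fin m) ℝ)
    (U : Set (EuclideanSpace ℝ (Fin m)))
    (g : Fin p → EuclideanSpace ℝ (Fin n) × EuclideanSpace ℝ (Fin m) → ℝ)
    (Q : Matrix (Fin n) (Fin n) ℝ) (S : Matrix (Fin n) (Fin m) ℝ) (R : Matrix (Fin m) (Fin m) ℝ) :
    ControlProblem n m where
  f x u := A.toEuclideanLin x + B.toEuclideanLin u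
  E := {z | z ∈ mixedConstraintSet g ∧ z.2 ∈ U}
  ℓ x u := Sum.elim x.ofLp u.ofLp ⬝ᵥ
    (Matrix.fromBlocks Q S S.transpose R).mulVec (Sum.elim x.ofLp u.ofLp)

end

/-!
Model predictive control of a constrained linear-quadratic problem without terminal conditions is
stabilising for long horizons.

**Lyapunov decrease.** Let `J(t)` be the cost to go at time `t` along an optimal trajectory from a
state with `V_T ≤ C`. Then `J(t) ≤ β ℓ⋆(x(t))`: inside the neighbourhood `W` by local cost
controllability, outside because `C ≤ (C / M) ℓ⋆` (`tail_le_beta_mul_ellStar`). Integration over a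
sampling period gives `J((k + 1) δ) ≤ β / (β + δ) J(k δ)` (`tail_le_pow_mul`). Hence the cost of the
last sampling period is exponentially small in `N`, and by averaging some state of that period has a
small stage cost. The first part of the horizon condition places this state in `W`, where the
trajectory can be continued at a cost of at most `γ ℓ⋆`. By (A3), the second part bounds this extra
cost by a fraction `α < 1` of the cost over the first sampling period, so that
`V_T(x(δ)) + (1 - α) ∫₀^δ ℓ ≤ V_T(x(0))` (`V_add_le_V`). In the closed loop the costs over the sampling
periods are therefore summable. They bound the squared norms of the states, because a trajectory
cannot move far at low cost (`ofReal_mul_norm_sq_le_cost`, by the Cauchy–Schwarz inequality), and this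
gives both convergence and Lyapunov stability (`closedLoop_stability`). The same estimate yields (A3),
with a constant that grows quadratically in `T`, which the geometric factor of the horizon condition
dominates (`exists_forall_horizonCondition`).

**Boundedness of `V_∞`.** The flow of a Hurwitz matrix decays exponentially, by Gelfand's formula
applied to its exponential (`IsHurwitz.exists_norm_exp_smul_le`). Near the origin this gives (A2). On a
compact set `K` in the interior of the viability kernel, `ρ⁻¹ K` is still viable for some `ρ < 1`. The
viable trajectory `(y, v)` from `ρ⁻¹ x₀` is damped to `ρ exp (-ε t) (y, v)`, and the disturbance that
the damping causes is absorbed by the stabilising feedback: the correction `e` with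
`e' = (A + B G) e + ε ρ exp (-ε t) y` has size of order `ε exp (-ε t)`, so for small `ε` it fits into
the margin left by the factor `ρ` in the convex constraint set. The resulting trajectory is admissible
and decays exponentially, uniformly in `x₀` (`exists_VInf_le_of_scaled`).
-/

/-! ### Exponential decay of the flow of a Hurwitz matrix -/

section ExpDecay
open NormedSpace

theorem exp_add_smul {𝔸 : Type*} [NormedRing 𝔸] [NormedAlgebra ℝ 𝔸] [CompleteSpace 𝔸]
    (a : 𝔸) (s t : ℝ) : exp ((s + t) • a) = exp (s • a) * exp (t • a) := by
  let : NormedAlgebra ℚ 𝔸 := NormedAlgebra.restrictScalars ℚ ℝ 𝔸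
  rw [add_smul, NormedSpace.exp_add_of_commute (((Commute.refl a).smul_left _).smul_right _)]

/-- In a real Banach algebra, one contracting power of `exp a` makes `t ↦ exp (t a)` decay
exponentially. -/
theorem exists_norm_exp_smul_le {𝔸 : Type*} [NormedRing 𝔸] [NormedAlgebra ℝ 𝔸] [CompleteSpace 𝔸]
    (a : 𝔸) {k : ℕ} (hk : 0 < k) (ha : ‖exp a ^ k‖ < 1) :
    ∃ c > 0, ∃ ω > 0, ∀ t : ℝ, 0 ≤ t → ‖exp (t • a)‖ ≤ c * Real.exp (-(ω * t)) := by
  let : NormedAlgebra ℚ 𝔸 := NormedAlgebra.restrictScalars ℚ ℝ 𝔸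
  have hk' : (0 : ℝ) < k := by exact_mod_cast hk
  -- a positive contraction factor, so that its logarithm is meaningful
  obtain ⟨θ, hθ₁, hθ₂⟩ := exists_between (max_lt ha (by norm_num : (1 / 2 : ℝ) < 1))
  have hθ₀ : 0 < θ := lt_of_lt_of_le (by norm_num) ((le_max_right _ _).trans hθ₁.le)
  have hθ : ‖exp a ^ k‖ ≤ θ := (le_max_left _ _).trans hθ₁.le
  have hcont : Continuous fun t : ℝ => exp (t • a) :=
    NormedSpace.exp_continuous.comp (continuous_id.smul continuous_const)
  obtain ⟨D, hD⟩ := (isCompact_Icc (a := (0 : ℝ)) (b := k)).exists_bound_of_continuousOn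
    hcont.continuousOn
  have hD₀ : 0 ≤ D := (norm_nonneg _).trans (hD 0 ⟨le_rfl, hk'.le⟩)
  have hlog : Real.log θ < 0 := Real.log_neg hθ₀ hθ₂
  have hfac : ∀ (j : ℕ) (r : ℝ), exp ((j * k + r) • a) = (exp a ^ k) ^ j * exp (r • a) := by
    intro j r
    rw [exp_add_smul]
    congr 1
    rw [← pow_mul, ← NormedSpace.exp_nsmul]
    congr 1
    rw [← Nat.cast_smul_eq_nsmul ℝ]
    push_cast
    rw [mul_comm]
  have key : ∀ (j : ℕ) (r : ℝ), r ∈ Icc (0 : ℝ) k →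
      ‖exp ((j * k + r) • a)‖ ≤ D * θ ^ j := by
    intro j r hr
    induction j with
    | zero => simpa using hD r hr
    | succ j ih =>
      rw [hfac, pow_succ', mul_assoc, ← hfac]
      calc _ ≤ ‖exp a ^ k‖ * ‖exp ((j * k + r) • a)‖ := norm_mul_le _ _
        _ ≤ θ * (D * θ ^ j) := by gcongr
        _ = _ := by ring
  refine ⟨(D + 1) / θ, by positivity, -Real.log θ / k, div_pos (neg_pos.2 hlog) hk', ?_⟩
  intro t ht
  set j := ⌊t / k⌋₊ with hj
  have hj1 : (j : ℝ) * k ≤ t := (le_div_iff₀ hk').1 (Nat.floor_le (by positivity))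
  have hj2 : t < (j + 1) * k := (div_lt_iff₀ hk').1 (Nat.lt_floor_add_one _)
  have h := key j (t - j * k) ⟨by linarith, by linarith⟩
  rw [add_sub_cancel] at h
  refine h.trans ?_
  have h4 : θ ^ (j + 1) ≤ Real.exp (-(-Real.log θ / k * t)) := by
    rw [← Real.exp_log (pow_pos hθ₀ _), Real.log_pow, Real.exp_le_exp]
    have : t / k ≤ j + 1 := by rw [div_le_iff₀ hk']; exact hj2.le
    push_cast
    calc ((j : ℝ) + 1) * Real.log θ ≤ (t / k) * Real.log θ :=
          mul_le_mul_of_nonpos_right this hlog.le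
      _ = _ := by ring
  calc D * θ ^ j ≤ (D + 1) * θ ^ j := by gcongr; linarith
    _ = (D + 1) / θ * θ ^ (j + 1) := by rw [pow_succ]; field_simp
    _ ≤ _ := by gcongr

/-- One inclusion of the spectral mapping theorem for the matrix exponential: on an
eigenspace of `exp M`, the commuting matrix `M` has an eigenvector. -/
theorem spectrum_exp_subset {n : ℕ} (M : Matrix (Fin n) (Fin n) ℂ) {z : ℂ}
    (hz : z ∈ spectrum ℂ (exp M)) : ∃ w ∈ spectrum ℂ M, z = Complex.exp w := by
  let e : Matrix (Fin n) (Fin n) ℂ ≃ₐ[ℂ] Module.End ℂ (Fin n → ℂ) := Matrix.toLinAlgEquiv'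
  rw [← AlgEquiv.spectrum_eq e, ← Module.End.hasEigenvalue_iff_mem_spectrum] at hz
  have hcomm : Commute (e M) (e (exp M)) := by
    have : Commute M (exp M) := by
      open scoped Matrix.Norms.Operator in exact (Commute.refl M).exp_right
    exact this.map e
  have hmaps := Module.End.mapsTo_genEigenspace_of_comm hcomm.symm z 1
  set W := Module.End.eigenspace (e (exp M)) z
  have hmaps : MapsTo (e M) W W := hmaps
  have hW : W ≠ ⊥ := hz
  have : Nontrivial W := Submodule.nontrivial_iff_ne_bot.2 hW
  obtain ⟨w, hw⟩ := Module.End.exists_eigenvalue ((e M).restrict hmaps)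
  obtain ⟨v, hv⟩ := hw.exists_hasEigenvector
  have hv0 : (v : Fin n → ℂ) ≠ 0 := by simpa using hv.2
  have hv1 : M.mulVec (v : Fin n → ℂ) = w • (v : Fin n → ℂ) := by
    exact congrArg Subtype.val hv.apply_eq_smul
  have hv2 : (exp M).mulVec (v : Fin n → ℂ) = z • (v : Fin n → ℂ) := by
    have := Module.End.mem_eigenspace_iff.1 v.2
    simpa [e] using this
  refine ⟨w, ?_, ?_⟩
  · rw [← AlgEquiv.spectrum_eq e, ← Module.End.hasEigenvalue_iff_mem_spectrum]
    exact Module.End.hasEigenvalue_of_hasEigenvector (x := (v : Fin n → ℂ))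
      (Module.End.hasEigenvector_iff.2 ⟨Module.End.mem_eigenspace_iff.2 (by simpa [e] using hv1), hv0⟩)
  · have h3 : (exp M).mulVec (v : Fin n → ℂ) = Complex.exp w • (v : Fin n → ℂ) := by
      open scoped Matrix.Norms.Operator in
      have hs := NormedSpace.exp_series_hasSum_exp' (𝕂 := ℂ) M
      have hs' := NormedSpace.exp_series_hasSum_exp' (𝕂 := ℂ) w
      rw [← Complex.exp_eq_exp_ℂ] at hs'
      have hp : ∀ k : ℕ, (M ^ k).mulVec (v : Fin n → ℂ) = w ^ k • (v : Fin n → ℂ) := by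
        intro k
        induction k with
        | zero => simp
        | succ k ih => rw [pow_succ, ← Matrix.mulVec_mulVec, hv1, Matrix.mulVec_smul, ih,
            smul_smul, pow_succ']
      have h4 := hs.map ((Matrix.mulVecBilin ℂ ℂ).flip (v : Fin n → ℂ)).toAddMonoidHom
        (by simpa using! (continuous_id.matrix_mulVec continuous_const))
      have h5 := hs'.smul_const (v : Fin n → ℂ)
      refine h4.unique (h5.congr_fun ?_)
      intro k
      simp [hp, smul_smul]
    rw [h3] at hv2
    exact (smul_left_injective ℂ hv0 hv2).symm

/-- All eigenvalues of `exp M` lie in the open unit disc when `M` is Hurwitz, so by Gelfand's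
formula some power of `exp M` is a contraction. -/
theorem IsHurwitz.exists_norm_exp_toEuclideanCLM_pow_lt {n : ℕ} {M : Matrix (Fin n) (Fin n) ℝ}
    (hM : IsHurwitz M) :
    ∃ k : ℕ, 0 < k ∧ ‖exp (Matrix.toEuclideanCLM (n := Fin n) (𝕜 := ℝ) M) ^ k‖ < 1 := by
  open scoped Matrix.Norms.Operator in
  let Mc : Matrix (Fin n) (Fin n) ℂ := M.map (algebraMap ℝ ℂ)
  have hpow : Tendsto (fun k : ℕ => exp Mc ^ k) atTop (𝓝 0) := by
    have hr : spectralRadius ℂ (exp Mc) < 1 := by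
      cases subsingleton_or_nontrivial (Matrix (Fin n) (Fin n) ℂ) with
      | inl h => simp [spectrum.SpectralRadius.of_subsingleton]
      | inr h =>
        refine spectrum.spectralRadius_lt_of_forall_lt (exp Mc) (r := 1) ?_
        intro z hz
        obtain ⟨w, hw, rfl⟩ := spectrum_exp_subset Mc hz
        have := hM w hw
        rw [← NNReal.coe_lt_coe, coe_nnnorm, Complex.norm_exp]
        simpa using this
    obtain ⟨r, hr1, hr2⟩ := exists_between hr
    have h1 := spectrum.pow_nnnorm_pow_one_div_tendsto_nhds_spectralRadius (exp Mc)
    have h2 : ∀ᶠ k : ℕ in atTop, (‖exp Mc ^ k‖₊ : ℝ≥0∞) ≤ r ^ k := by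
      filter_upwards [h1.eventually_lt_const hr1, eventually_gt_atTop 0] with k hk hk0
      have hk0' : (0 : ℝ) < k := by exact_mod_cast hk0
      have := ENNReal.rpow_le_rpow hk.le hk0'.le
      rwa [← ENNReal.rpow_mul, one_div, inv_mul_cancel₀ hk0'.ne', ENNReal.rpow_one,
        ENNReal.rpow_natCast] at this
    refine tendsto_zero_iff_enorm_tendsto_zero.2 ?_
    exact tendsto_of_tendsto_of_tendsto_of_le_of_le' tendsto_const_nhds
      (ENNReal.tendsto_pow_atTop_nhds_zero_of_lt_one hr2) (Eventually.of_forall fun _ => zero_le) h2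
  have hmap : exp Mc = (exp M).map (algebraMap ℝ ℂ) := by
    have hc : Continuous ((algebraMap ℝ ℂ).mapMatrix : Matrix (Fin n) (Fin n) ℝ →+* _) :=
      continuous_id.matrix_map Complex.continuous_ofReal
    exact (NormedSpace.map_exp ((algebraMap ℝ ℂ).mapMatrix) hc M).symm
  have hpow' : Tendsto (fun k : ℕ => exp M ^ k) atTop (𝓝 0) := by
    have hre : Continuous fun N : Matrix (Fin n) (Fin n) ℂ => N.map Complex.re :=
      continuous_id.matrix_map Complex.continuous_re
    have h := (hre.tendsto 0).comp hpow
    have h0 : (0 : Matrix (Fin n) (Fin n) ℂ).map Complex.re = 0 := by ext; simp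
    rw [h0] at h
    refine h.congr fun k => ?_
    have : exp Mc ^ k = (exp M ^ k).map (algebraMap ℝ ℂ) := by
      rw [hmap]
      exact (map_pow ((algebraMap ℝ ℂ).mapMatrix) (exp M) k).symm
    rw [Function.comp_apply, this]
    ext i j
    simp
  have hcont : Continuous (Matrix.toEuclideanCLM (n := Fin n) (𝕜 := ℝ)) :=
    LinearMap.continuous_of_finiteDimensional
      (Matrix.toEuclideanCLM (n := Fin n) (𝕜 := ℝ)).toAlgEquiv.toLinearMap
  have hexp : Matrix.toEuclideanCLM (n := Fin n) (𝕜 := ℝ) (exp M) =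
      exp (Matrix.toEuclideanCLM (n := Fin n) (𝕜 := ℝ) M) := by
    let : NormedAlgebra ℚ (EuclideanSpace ℝ (Fin n) →L[ℝ] EuclideanSpace ℝ (Fin n)) :=
      NormedAlgebra.restrictScalars ℚ ℝ _
    exact NormedSpace.map_exp _ hcont M
  have hlim := (hcont.tendsto 0).comp hpow'
  rw [map_zero] at hlim
  obtain ⟨k, hk, hk0⟩ := ((hlim.norm.eventually_lt_const (u := 1) (by simp)).and
    (eventually_gt_atTop 0)).exists
  refine ⟨k, hk0, ?_⟩
  rw [← hexp, ← map_pow]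
  exact hk

/-- The flow of a Hurwitz matrix decays exponentially. -/
theorem IsHurwitz.exists_norm_exp_smul_le {n : ℕ} {M : Matrix (Fin n) (Fin n) ℝ}
    (hM : IsHurwitz M) : ∃ c > 0, ∃ ω > 0, ∀ t : ℝ, 0 ≤ t →
      ‖exp (t • Matrix.toEuclideanCLM (n := Fin n) (𝕜 := ℝ) M)‖ ≤ c * Real.exp (-(ω * t)) := by
  obtain ⟨k, hk, h⟩ := hM.exists_norm_exp_toEuclideanCLM_pow_lt
  exact _root_.exists_norm_exp_smul_le _ hk h

end ExpDecay

/-! ### Linear-quadratic problems and the minimal stage cost -/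

namespace ControlProblem

variable {n m : ℕ}

/-- The features of the constrained linear-quadratic problem that the stability analysis uses:
linear dynamics `ẋ = A x + B u`, a stage cost enclosed between the multiples `c₁` and `c₂` of the
squared norm of the pair `(x, u)` (the product norm, that is, the larger of the two Euclidean
norms), and a compact convex constraint set around the origin. -/
structure IsLinearQuadratic (P : ControlProblem n m)
    (A : EuclideanSpace ℝ (Fin n) →L[ℝ] EuclideanSpace ℝ (Fin n))
    (B : EuclideanSpace ℝ (Fin m) →L[ℝ] EuclideanSpace ℝ (Fin n)) (c₁ c₂ : ℝ) : Prop where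
  f_eq : ∀ x u, P.f x u = A x + B u
  continuous_ell : Continuous fun z : EuclideanSpace ℝ (Fin n) × EuclideanSpace ℝ (Fin m) =>
    P.ℓ z.1 z.2
  c₁_pos : 0 < c₁
  c₂_pos : 0 < c₂
  le_ell : ∀ x u, c₁ * ‖(x, u)‖ ^ 2 ≤ P.ℓ x u
  ell_le : ∀ x u, P.ℓ x u ≤ c₂ * ‖(x, u)‖ ^ 2
  convex_E : Convex ℝ P.E
  isCompact_E : IsCompact P.E
  zero_mem_interior : 0 ∈ interior P.E

namespace IsLinearQuadratic

variable {P : ControlProblem n m} {A : EuclideanSpace ℝ (Fin n) →L[ℝ] EuclideanSpace ℝ (Fin n)}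
  {B : EuclideanSpace ℝ (Fin m) →L[ℝ] EuclideanSpace ℝ (Fin n)} {c₁ c₂ : ℝ}

theorem ell_nonneg (hP : P.IsLinearQuadratic A B c₁ c₂) (x : EuclideanSpace ℝ (Fin n))
    (u : EuclideanSpace ℝ (Fin m)) : 0 ≤ P.ℓ x u :=
  (mul_nonneg hP.c₁_pos.le (sq_nonneg _)).trans (hP.le_ell x u)

theorem exists_ball_subset (hP : P.IsLinearQuadratic A B c₁ c₂) :
    ∃ r > 0, ∀ z : EuclideanSpace ℝ (Fin n) × EuclideanSpace ℝ (Fin m), ‖z‖ ≤ r → z ∈ P.E := by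
  obtain ⟨r, hr, h⟩ := Metric.mem_nhds_iff.1 (mem_interior_iff_mem_nhds.1 hP.zero_mem_interior)
  refine ⟨r / 2, by positivity, fun z hz => h ?_⟩
  rw [mem_ball_zero_iff]
  linarith

theorem exists_norm_le (hP : P.IsLinearQuadratic A B c₁ c₂) :
    ∃ R > 0, ∀ z ∈ P.E, ‖z‖ ≤ R :=
  hP.isCompact_E.isBounded.exists_pos_norm_le

theorem zero_mem_E (hP : P.IsLinearQuadratic A B c₁ c₂) : (0, 0) ∈ P.E :=
  interior_subset hP.zero_mem_interior

theorem ellStar_le (hP : P.IsLinearQuadratic A B c₁ c₂) {x : EuclideanSpace ℝ (Fin n)}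
    {u : EuclideanSpace ℝ (Fin m)} (h : (x, u) ∈ P.E) : P.ellStar x ≤ P.ℓ x u :=
  csInf_le ⟨0, by rintro _ ⟨v, -, rfl⟩; exact hP.ell_nonneg x v⟩ ⟨u, h, rfl⟩

theorem mul_sq_le_ellStar (hP : P.IsLinearQuadratic A B c₁ c₂) {x : EuclideanSpace ℝ (Fin n)}
    (hx : x ∈ P.stateSet) : c₁ * ‖x‖ ^ 2 ≤ P.ellStar x := by
  refine le_csInf (hx.image _) ?_
  rintro _ ⟨u, -, rfl⟩
  refine le_trans ?_ (hP.le_ell x u)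
  have := hP.c₁_pos
  gcongr
  exact norm_fst_le (x, u)

theorem ellStar_nonneg (hP : P.IsLinearQuadratic A B c₁ c₂) {x : EuclideanSpace ℝ (Fin n)}
    (hx : x ∈ P.stateSet) : 0 ≤ P.ellStar x :=
  (mul_nonneg hP.c₁_pos.le (sq_nonneg _)).trans (hP.mul_sq_le_ellStar hx)

/-- Near the origin the control `0` is feasible, and away from it the stage cost is bounded on the
compact constraint set, so the minimal stage cost grows at most quadratically. -/
theorem exists_ellStar_le_mul_sq (hP : P.IsLinearQuadratic A B c₁ c₂) :
    ∃ c > 0, ∀ x ∈ P.stateSet, P.ellStar x ≤ c * ‖x‖ ^ 2 := by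
  obtain ⟨r, hr, hrE⟩ := hP.exists_ball_subset
  obtain ⟨R, hR, hRE⟩ := hP.exists_norm_le
  have h2 := hP.c₂_pos
  refine ⟨c₂ + c₂ * R ^ 2 / r ^ 2, by positivity, ?_⟩
  rintro x ⟨u, hu⟩
  rw [add_mul]
  by_cases hx : ‖x‖ ≤ r
  · have h0 : ‖((x, 0) : EuclideanSpace ℝ (Fin n) × EuclideanSpace ℝ (Fin m))‖ = ‖x‖ := by
      simp [Prod.norm_def]
    have h := (hP.ellStar_le (hrE (x, 0) (h0.trans_le hx))).trans (hP.ell_le x 0)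
    rw [h0] at h
    exact h.trans (le_add_of_nonneg_right (by positivity))
  · have h := (hP.ellStar_le hu).trans (hP.ell_le x u)
    have h3 : c₂ * ‖(x, u)‖ ^ 2 ≤ c₂ * R ^ 2 := by gcongr; exact hRE _ hu
    have h4 : c₂ * R ^ 2 ≤ c₂ * R ^ 2 / r ^ 2 * ‖x‖ ^ 2 := by
      rw [div_mul_eq_mul_div, le_div_iff₀ (by positivity)]
      push Not at hx
      gcongr
    have : 0 ≤ c₂ * ‖x‖ ^ 2 := by positivity
    linarith

theorem isClassKInf_mul_sq {c : ℝ≥0} (hc : 0 < c) : IsClassKInf fun s => c * s ^ 2 := by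
  refine ⟨by fun_prop, ?_, by simp, ?_⟩
  · intro s t hst
    have : s ^ 2 < t ^ 2 := pow_lt_pow_left₀ hst zero_le two_ne_zero
    exact mul_lt_mul_of_pos_left this hc
  · exact (tendsto_pow_atTop two_ne_zero).const_mul_atTop hc

theorem a1 (hP : P.IsLinearQuadratic A B c₁ c₂) : P.A1 := by
  obtain ⟨c, hc, h⟩ := hP.exists_ellStar_le_mul_sq
  refine ⟨_, _, isClassKInf_mul_sq (c := ⟨c₁, hP.c₁_pos.le⟩) hP.c₁_pos,
    isClassKInf_mul_sq (c := ⟨c, hc.le⟩) hc, fun x hx => ⟨?_, ?_⟩⟩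
  · exact hP.mul_sq_le_ellStar hx
  · exact h x hx

/-- Outside the neighbourhood `W` the level `C` is at most `C / M` times the minimal stage cost. The
quotient is not a junk value, because `M > 0`. -/
theorem le_ratio_mul_ellStar (hP : P.IsLinearQuadratic A B c₁ c₂) {C : ℝ}
    {W : Set (EuclideanSpace ℝ (Fin n))} (hW : W ∈ 𝓝 0) {x : EuclideanSpace ℝ (Fin n)}
    (hx : x ∈ P.stateSet) (hxW : x ∉ W) : C ≤ P.ratio C W * P.ellStar x := by
  obtain ⟨r, hr, hrW⟩ := Metric.mem_nhds_iff.1 hW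
  have hM0 : P.M W ≠ 0 := by
    have h : ENNReal.ofReal (c₁ * r ^ 2) ≤ P.M W := by
      refine le_iInf₂ fun y hy => ENNReal.ofReal_le_ofReal ((?_ : _ ≤ _).trans
        (hP.mul_sq_le_ellStar hy.1))
      have : r ≤ ‖y‖ := by
        by_contra! h
        exact hy.2 (hrW (by simpa using h))
      have := hP.c₁_pos
      gcongr
    have h1 : 0 < ENNReal.ofReal (c₁ * r ^ 2) :=
      ENNReal.ofReal_pos.2 (by have := hP.c₁_pos; positivity)
    exact (h1.trans_le h).ne'
  have hMle : P.M W ≤ ENNReal.ofReal (P.ellStar x) := iInf₂_le x ⟨hx, hxW⟩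
  have hMtop : P.M W ≠ ⊤ := (hMle.trans_lt ENNReal.ofReal_lt_top).ne
  have hM : 0 < (P.M W).toReal := ENNReal.toReal_pos hM0 hMtop
  have hMle' : (P.M W).toReal ≤ P.ellStar x :=
    ENNReal.toReal_le_of_le_ofReal (hP.ellStar_nonneg hx) hMle
  rcases le_total C 0 with hC | hC
  · exact hC.trans (mul_nonneg ENNReal.toReal_nonneg (hP.ellStar_nonneg hx))
  · rw [ratio, ENNReal.toReal_div, ENNReal.toReal_ofReal hC, div_mul_eq_mul_div, le_div_iff₀ hM]
    gcongr

end IsLinearQuadratic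
end ControlProblem

/-! ### Trajectories and their cost -/

namespace ControlProblem

variable {n m : ℕ}

theorem value_le_cost {P : ControlProblem n m} {I : Set ℝ} {x₀ : EuclideanSpace ℝ (Fin n)}
    {u : ℝ → EuclideanSpace ℝ (Fin m)} {x : ℝ → EuclideanSpace ℝ (Fin n)}
    (h : P.IsAdmissiblePair I x₀ u x) : P.value I x₀ ≤ P.cost I u x :=
  iInf_le_of_le u (iInf_le_of_le x (iInf_le _ h))

theorem IsAdmissiblePair.mono {P : ControlProblem n m} {I J : Set ℝ}
    {x₀ : EuclideanSpace ℝ (Fin n)} {u : ℝ → EuclideanSpace ℝ (Fin m)}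
    {x : ℝ → EuclideanSpace ℝ (Fin n)} (h : P.IsAdmissiblePair J x₀ u x) (hIJ : I ⊆ J) :
    P.IsAdmissiblePair I x₀ u x :=
  ⟨h.1, ⟨h.2.1.1.mono hIJ, fun t ht => h.2.1.2 t (hIJ ht)⟩, fun t ht => h.2.2 t (hIJ ht)⟩

theorem _root_.IsControl.aestronglyMeasurable_prod {u : ℝ → EuclideanSpace ℝ (Fin m)}
    {x : ℝ → EuclideanSpace ℝ (Fin n)} {T : ℝ} (hu : IsControl u) (hx : ContinuousOn x (Icc 0 T)) :
    AEStronglyMeasurable (fun s => (x s, u s)) (volume.restrict (Icc 0 T)) :=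
  (hx.aestronglyMeasurable measurableSet_Icc).prodMk
    (hu.1.mono_measure (Measure.restrict_mono Icc_subset_Ici_self le_rfl)).aestronglyMeasurable

theorem _root_.IsControl.exists_ae_norm_prod_le {u : ℝ → EuclideanSpace ℝ (Fin m)}
    {x : ℝ → EuclideanSpace ℝ (Fin n)} {T : ℝ} (hu : IsControl u) (hx : ContinuousOn x (Icc 0 T)) :
    ∃ c, ∀ᵐ s ∂(volume.restrict (Icc 0 T)), ‖(x s, u s)‖ ≤ c := by
  obtain ⟨c, hc⟩ := hu.2 T
  obtain ⟨d, hd⟩ := isCompact_Icc.exists_bound_of_continuousOn hx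
  refine ⟨max d c, ?_⟩
  filter_upwards [hc, ae_restrict_mem measurableSet_Icc] with s h1 h2
  exact max_le_max (hd s h2) h1

theorem _root_.IsControl.integrableOn_prod {u : ℝ → EuclideanSpace ℝ (Fin m)}
    {x : ℝ → EuclideanSpace ℝ (Fin n)} {T : ℝ} (hu : IsControl u) (hx : ContinuousOn x (Icc 0 T)) :
    IntegrableOn (fun s => (x s, u s)) (Icc 0 T) := by
  obtain ⟨c, hc⟩ := hu.exists_ae_norm_prod_le hx
  exact Integrable.of_bound (hu.aestronglyMeasurable_prod hx) c hc

theorem _root_.IsControl.integrableOn_norm_sq {u : ℝ → EuclideanSpace ℝ (Fin m)}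
    {x : ℝ → EuclideanSpace ℝ (Fin n)} {T : ℝ} (hu : IsControl u) (hx : ContinuousOn x (Icc 0 T)) :
    IntegrableOn (fun s => ‖(x s, u s)‖ ^ 2) (Icc 0 T) := by
  obtain ⟨c, hc⟩ := hu.exists_ae_norm_prod_le hx
  refine Integrable.of_bound ((hu.aestronglyMeasurable_prod hx).norm.pow 2) (c ^ 2) ?_
  filter_upwards [hc] with s hs
  rw [norm_pow, norm_norm]
  gcongr

namespace IsLinearQuadratic

variable {P : ControlProblem n m} {A : EuclideanSpace ℝ (Fin n) →L[ℝ] EuclideanSpace ℝ (Fin n)}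
  {B : EuclideanSpace ℝ (Fin m) →L[ℝ] EuclideanSpace ℝ (Fin n)} {c₁ c₂ : ℝ}
  {u : ℝ → EuclideanSpace ℝ (Fin m)} {x : ℝ → EuclideanSpace ℝ (Fin n)}
  {x₀ : EuclideanSpace ℝ (Fin n)} {T : ℝ}

theorem f_eq_coprod (hP : P.IsLinearQuadratic A B c₁ c₂) (x : EuclideanSpace ℝ (Fin n))
    (u : EuclideanSpace ℝ (Fin m)) : P.f x u = A.coprod B (x, u) := by
  simp [hP.f_eq]

theorem integrableOn_f (hP : P.IsLinearQuadratic A B c₁ c₂) (hu : IsControl u)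
    (hx : ContinuousOn x (Icc 0 T)) : IntegrableOn (fun s => P.f (x s) (u s)) (Icc 0 T) := by
  simp_rw [hP.f_eq_coprod]
  exact (A.coprod B).integrable_comp (hu.integrableOn_prod hx)

theorem intervalIntegrable_f (hP : P.IsLinearQuadratic A B c₁ c₂) (hu : IsControl u)
    (hx : ContinuousOn x (Icc 0 T)) {a b : ℝ} (ha : a ∈ Icc 0 T) (hb : b ∈ Icc 0 T) :
    IntervalIntegrable (fun s => P.f (x s) (u s)) volume a b :=
  ((hP.integrableOn_f hu hx).mono_set (uIcc_subset_Icc ha hb)).intervalIntegrable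

theorem aemeasurable_ell (hP : P.IsLinearQuadratic A B c₁ c₂) (hu : IsControl u)
    (hx : ContinuousOn x (Icc 0 T)) :
    AEMeasurable (fun s => P.ℓ (x s) (u s)) (volume.restrict (Icc 0 T)) :=
  hP.continuous_ell.measurable.comp_aemeasurable
    (hu.aestronglyMeasurable_prod hx).aemeasurable

theorem integrableOn_ell (hP : P.IsLinearQuadratic A B c₁ c₂) (hu : IsControl u)
    (hx : ContinuousOn x (Icc 0 T)) : IntegrableOn (fun s => P.ℓ (x s) (u s)) (Icc 0 T) := by
  refine ((hu.integrableOn_norm_sq hx).const_mul c₂).mono'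
    (hP.aemeasurable_ell hu hx).aestronglyMeasurable (Eventually.of_forall fun s => ?_)
  rw [Real.norm_of_nonneg (hP.ell_nonneg _ _)]
  exact hP.ell_le _ _

/-- A solution differs between two times by the integral of the velocity between them. -/
theorem sub_eq_integral (hP : P.IsLinearQuadratic A B c₁ c₂) (hu : IsControl u)
    (hx : P.IsSolution (Icc 0 T) x₀ u x) {a b : ℝ} (ha : a ∈ Icc 0 T) (hb : b ∈ Icc 0 T) :
    x b - x a = ∫ s in a..b, P.f (x s) (u s) := by
  have h0 : (0 : ℝ) ∈ Icc 0 T := ⟨le_rfl, ha.1.trans ha.2⟩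
  rw [hx.2 a ha, hx.2 b hb, add_sub_add_left_eq_sub,
    intervalIntegral.integral_interval_sub_left (hP.intervalIntegrable_f hu hx.1 h0 hb)
      (hP.intervalIntegrable_f hu hx.1 h0 ha)]

/-- The Cauchy–Schwarz inequality on an interval, from the nonnegative integral of `(g - a)²` with
the mean value `a`. -/
theorem _root_.sq_setIntegral_le_mul {g : ℝ → ℝ} {T : ℝ} (hT : 0 < T)
    (hg : IntegrableOn g (Icc 0 T)) (hg2 : IntegrableOn (fun s => g s ^ 2) (Icc 0 T)) :
    (∫ s in Icc 0 T, g s) ^ 2 ≤ T * ∫ s in Icc 0 T, g s ^ 2 := by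
  set G := ∫ s in Icc 0 T, g s with hG
  have h : 0 ≤ ∫ s in Icc 0 T, (g s - G / T) ^ 2 := integral_nonneg fun s => sq_nonneg _
  have h1 : ∫ s in Icc 0 T, (g s - G / T) ^ 2 =
      (∫ s in Icc 0 T, g s ^ 2) - (2 * (G / T)) * G + T * (G / T) ^ 2 := by
    have h2 : ∀ s, (g s - G / T) ^ 2 = g s ^ 2 - (2 * (G / T)) * g s + (G / T) ^ 2 := by
      intro s; ring
    simp_rw [h2]
    have h3 : IntegrableOn (fun s => g s ^ 2 - 2 * (G / T) * g s) (Icc 0 T) :=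
      hg2.sub (hg.const_mul _)
    rw [integral_add h3 (integrable_const _), integral_sub hg2 (hg.const_mul _),
      integral_const_mul]
    simp [hT.le, hG]
  rw [h1] at h
  have h3 : T * ((∫ s in Icc 0 T, g s ^ 2) - (2 * (G / T)) * G + T * (G / T) ^ 2) =
      T * (∫ s in Icc 0 T, g s ^ 2) - G ^ 2 := by field_simp; ring
  have := mul_nonneg hT.le h
  rw [h3] at this
  linarith

/-- Each state of a trajectory on `[0, T]` is controlled by the cost: the trajectory is close to that
state in the mean, since by the Cauchy–Schwarz inequality it cannot move far at low cost. -/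
theorem ofReal_mul_norm_sq_le_cost (hP : P.IsLinearQuadratic A B c₁ c₂) (hT : 0 < T)
    (hu : IsControl u) (hx : P.IsSolution (Icc 0 T) x₀ u x) {s₀ : ℝ} (hs₀ : s₀ ∈ Icc 0 T) :
    ENNReal.ofReal (T * ‖x s₀‖ ^ 2) ≤
      ENNReal.ofReal ((2 + 2 * (‖A.coprod B‖ * T) ^ 2) / c₁) * P.cost (Icc 0 T) u x := by
  set L := ‖A.coprod B‖ with hL
  set G := ∫ s in Icc 0 T, ‖(x s, u s)‖ ^ 2 with hG
  have hint := hu.integrableOn_prod hx.1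
  have hint2 := hu.integrableOn_norm_sq hx.1
  have hdist : ∀ t ∈ Icc 0 T, ‖x t - x s₀‖ ^ 2 ≤ L ^ 2 * (T * G) := by
    intro t ht
    have h1 : ‖x t - x s₀‖ ≤ L * ∫ s in Icc 0 T, ‖(x s, u s)‖ := by
      rw [hP.sub_eq_integral hu hx hs₀ ht]
      calc _ ≤ ∫ s in uIoc s₀ t, ‖P.f (x s) (u s)‖ :=
            intervalIntegral.norm_integral_le_integral_norm_uIoc
        _ ≤ ∫ s in Icc 0 T, ‖P.f (x s) (u s)‖ := by
            refine setIntegral_mono_set (hP.integrableOn_f hu hx.1).norm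
              (Eventually.of_forall fun _ => norm_nonneg _) (Eventually.of_forall ?_)
            exact uIoc_subset_uIcc.trans (uIcc_subset_Icc hs₀ ht)
        _ ≤ ∫ s in Icc 0 T, L * ‖(x s, u s)‖ := by
            refine integral_mono (hP.integrableOn_f hu hx.1).norm (hint.norm.const_mul _) ?_
            intro s
            simp only [hP.f_eq_coprod]
            exact (A.coprod B).le_opNorm _
        _ = _ := integral_const_mul _ _
    calc ‖x t - x s₀‖ ^ 2 ≤ (L * ∫ s in Icc 0 T, ‖(x s, u s)‖) ^ 2 := by gcongr
      _ = L ^ 2 * (∫ s in Icc 0 T, ‖(x s, u s)‖) ^ 2 := mul_pow _ _ _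
      _ ≤ _ := by
        gcongr
        exact sq_setIntegral_le_mul hT hint.norm hint2
  have hmain : T * ‖x s₀‖ ^ 2 ≤ (2 + 2 * (L * T) ^ 2) * G := by
    have h1 : ∫ s in Icc 0 T, ‖x s₀‖ ^ 2 ≤
        ∫ s in Icc 0 T, (2 * ‖(x s, u s)‖ ^ 2 + 2 * (L ^ 2 * (T * G))) := by
      refine setIntegral_mono_on (by simp) ((hint2.const_mul 2).add (integrable_const _)) measurableSet_Icc ?_
      intro s hs
      have h2 := hdist s hs
      have h3 : ‖x s‖ ≤ ‖(x s, u s)‖ := norm_fst_le (x s, u s)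
      have h4 : ‖x s₀‖ ≤ ‖(x s, u s)‖ + ‖x s - x s₀‖ := by
        have := norm_le_norm_add_norm_sub (x s) (x s₀)
        linarith
      have h5 : ‖x s₀‖ ^ 2 ≤ (‖(x s, u s)‖ + ‖x s - x s₀‖) ^ 2 := by gcongr
      nlinarith [sq_nonneg (‖(x s, u s)‖ - ‖x s - x s₀‖)]
    rw [integral_add (hint2.const_mul 2) (integrable_const _), integral_const_mul] at h1
    simp only [integral_const, MeasurableSet.univ, measureReal_restrict_apply, univ_inter,
      Real.volume_real_Icc_of_le hT.le, sub_zero, smul_eq_mul] at h1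
    rw [← hG] at h1
    linarith
  have hcost : ENNReal.ofReal (c₁ * G) ≤ P.cost (Icc 0 T) u x := by
    rw [hG, ← integral_const_mul, ofReal_integral_eq_lintegral_ofReal (hint2.const_mul _)
      (Eventually.of_forall fun s => mul_nonneg hP.c₁_pos.le (sq_nonneg _))]
    exact lintegral_mono fun s => ENNReal.ofReal_le_ofReal (hP.le_ell _ _)
  have hc := hP.c₁_pos
  calc ENNReal.ofReal (T * ‖x s₀‖ ^ 2)
      ≤ ENNReal.ofReal ((2 + 2 * (L * T) ^ 2) / c₁ * (c₁ * G)) := by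
        refine ENNReal.ofReal_le_ofReal (hmain.trans_eq ?_)
        field_simp
    _ = ENNReal.ofReal ((2 + 2 * (L * T) ^ 2) / c₁) * ENNReal.ofReal (c₁ * G) :=
        ENNReal.ofReal_mul (by positivity)
    _ ≤ _ := by gcongr

/-- Condition (A3) holds with a constant that grows only quadratically in `T` and does not depend on
`C`. -/
theorem exists_a3 (hP : P.IsLinearQuadratic A B c₁ c₂) :
    ∃ a > 0, ∃ b ≥ 0, ∀ T C, P.A3 T C (a + b * T ^ 2) := by
  obtain ⟨c, hc, hcX⟩ := hP.exists_ellStar_le_mul_sq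
  have hc1 := hP.c₁_pos
  refine ⟨c * 2 / c₁, by positivity, c * (2 * ‖A.coprod B‖ ^ 2) / c₁, by positivity, ?_⟩
  intro T C
  refine ⟨by positivity, ?_⟩
  rintro δ ⟨hδ, hδT⟩ x₀ hx₀
  rw [V, value, ENNReal.mul_iInf_of_ne (by positivity) ENNReal.ofReal_ne_top]
  refine le_iInf fun u => ?_
  rw [ENNReal.mul_iInf_of_ne (by positivity) ENNReal.ofReal_ne_top]
  refine le_iInf fun x => ?_
  rw [ENNReal.mul_iInf_of_ne (by positivity) ENNReal.ofReal_ne_top]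
  refine le_iInf fun hux => ?_
  have h0 : (0 : ℝ) ∈ Icc 0 δ := ⟨le_rfl, hδ.le⟩
  have hx0 : x 0 = x₀ := by simpa using hux.2.1.2 0 h0
  have h := hP.ofReal_mul_norm_sq_le_cost hδ hux.1 hux.2.1 h0
  rw [hx0] at h
  calc ENNReal.ofReal (δ * P.ellStar x₀)
      ≤ ENNReal.ofReal (c * (δ * ‖x₀‖ ^ 2)) := by
        refine ENNReal.ofReal_le_ofReal ?_
        calc δ * P.ellStar x₀ ≤ δ * (c * ‖x₀‖ ^ 2) := by gcongr; exact hcX _ hx₀.1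
          _ = _ := by ring
    _ = ENNReal.ofReal c * ENNReal.ofReal (δ * ‖x₀‖ ^ 2) := ENNReal.ofReal_mul hc.le
    _ ≤ ENNReal.ofReal c * (ENNReal.ofReal ((2 + 2 * (‖A.coprod B‖ * δ) ^ 2) / c₁) *
          P.cost (Icc 0 δ) u x) := by gcongr
    _ = ENNReal.ofReal (c * ((2 + 2 * (‖A.coprod B‖ * δ) ^ 2) / c₁)) * P.cost (Icc 0 δ) u x := by
        rw [← mul_assoc, ENNReal.ofReal_mul hc.le]
    _ ≤ _ := by
        gcongr
        calc c * ((2 + 2 * (‖A.coprod B‖ * δ) ^ 2) / c₁)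
            ≤ c * ((2 + 2 * (‖A.coprod B‖ * T) ^ 2) / c₁) := by gcongr
          _ = _ := by ring

end IsLinearQuadratic
end ControlProblem

/-! ### Exponentially decaying admissible trajectories -/

/-- The primitive of a bounded integrable function is absolutely continuous, as it is Lipschitz. -/
theorem absolutelyContinuousOnInterval_primitive {F : Type*} [NormedAddCommGroup F]
    [NormedSpace ℝ F] {f : ℝ → F} {t c : ℝ} (ht : 0 ≤ t)
    (hf : IntervalIntegrable f volume 0 t) (hc : ∀ s ∈ Icc 0 t, ‖f s‖ ≤ c) :
    AbsolutelyContinuousOnInterval (fun s => ∫ r in (0 : ℝ)..s, f r) 0 t := by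
  refine LipschitzOnWith.absolutelyContinuousOnInterval (K := c.toNNReal) ?_
  rw [uIcc_of_le ht]
  have hint : ∀ a ∈ Icc 0 t, IntervalIntegrable f volume 0 a := fun a ha =>
    hf.mono_set (by rw [uIcc_of_le ha.1, uIcc_of_le ht]; exact Icc_subset_Icc_right ha.2)
  refine LipschitzOnWith.of_dist_le_mul fun a ha b hb => ?_
  rw [dist_eq_norm, intervalIntegral.integral_interval_sub_left (hint a ha) (hint b hb),
    Real.coe_toNNReal', Real.dist_eq]
  refine intervalIntegral.norm_integral_le_of_norm_le_const fun s hs => ?_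
  exact (hc s (uIcc_subset_Icc hb ha (uIoc_subset_uIcc hs))).trans (le_max_left _ _)

/-- The product rule in integrated form, for a smooth scalar factor and the primitive of a bounded
measurable function: both sides are absolutely continuous with the same derivative almost
everywhere. -/
theorem smul_primitive_eq_integral {F : Type*} [NormedAddCommGroup F] [NormedSpace ℝ F]
    [CompleteSpace F] {f X : ℝ → F} {φ φ' : ℝ → ℝ} {t c : ℝ} {y : F} (ht : 0 ≤ t)
    (hf : IntervalIntegrable f volume 0 t) (hc : ∀ s ∈ Icc 0 t, ‖f s‖ ≤ c)
    (hφ : ∀ s, HasDerivAt φ (φ' s) s) (hφ' : Continuous φ')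
    (hX : ∀ s ∈ Icc 0 t, X s = y + ∫ r in (0 : ℝ)..s, f r) :
    φ t • X t = φ 0 • y + ∫ s in (0 : ℝ)..t, (φ' s • X s + φ s • f s) := by
  set Y : ℝ → F := fun s => ∫ r in (0 : ℝ)..s, f r with hY
  have hYac : AbsolutelyContinuousOnInterval Y 0 t :=
    absolutelyContinuousOnInterval_primitive ht hf hc
  have hφc : Continuous φ := continuous_iff_continuousAt.2 fun s => (hφ s).continuousAt
  have hφac : AbsolutelyContinuousOnInterval φ 0 t := by
    refine ContDiffOn.absolutelyContinuousOnInterval (ContDiff.contDiffOn ?_)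
    rw [contDiff_one_iff_deriv]
    exact ⟨fun s => (hφ s).differentiableAt, by rwa [show deriv φ = φ' from
      funext fun s => (hφ s).deriv]⟩
  set g : ℝ → F := fun s => φ' s • (y + Y s) + φ s • f s with hg
  have hYc : ContinuousOn (fun s => y + Y s) (Icc 0 t) := by
    have := hYac.continuousOn
    rw [uIcc_of_le ht] at this
    exact continuousOn_const.add this
  have hgint : IntervalIntegrable g volume 0 t := by
    refine IntervalIntegrable.add ?_ ?_
    · refine ContinuousOn.intervalIntegrable ?_
      rw [uIcc_of_le ht]
      exact hφ'.continuousOn.smul hYc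
    · exact hf.continuousOn_smul hφc.continuousOn
  obtain ⟨d₁, hd₁⟩ := isCompact_Icc.exists_bound_of_continuousOn (hφ'.continuousOn.smul hYc)
  obtain ⟨d₂, hd₂⟩ := isCompact_Icc.exists_bound_of_continuousOn
    (hφc.continuousOn (s := Icc 0 t))
  have hgb : ∀ s ∈ Icc 0 t, ‖g s‖ ≤ d₁ + d₂ * c := by
    intro s hs
    refine (norm_add_le _ _).trans (add_le_add (hd₁ s hs) ?_)
    rw [norm_smul]
    exact mul_le_mul (hd₂ s hs) (hc s hs) (norm_nonneg _) ((norm_nonneg _).trans (hd₂ s hs))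
  have hGac := absolutelyContinuousOnInterval_primitive ht hgint hgb
  have hyac : AbsolutelyContinuousOnInterval (fun _ : ℝ => y) 0 t :=
    (contDiff_const (𝕜 := ℝ) (n := 1)).contDiffOn.absolutelyContinuousOnInterval
  have hD : AbsolutelyContinuousOnInterval
      (fun s => φ s • (y + Y s) - ∫ r in (0 : ℝ)..s, g r) 0 t :=
    (hφac.smul (hyac.add hYac)).sub hGac
  have hD0 : ∀ᵐ s, s ∈ uIcc 0 t →
      HasDerivAt (fun s => φ s • (y + Y s) - ∫ r in (0 : ℝ)..s, g r) 0 s := by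
    filter_upwards [hf.ae_hasDerivAt_integral, hgint.ae_hasDerivAt_integral] with s h1 h2 hs
    have h3 := h1 hs 0 left_mem_uIcc
    have h4 := h2 hs 0 left_mem_uIcc
    have h5 := ((hφ s).smul (h3.const_add y)).sub h4
    convert! h5 using 1
    simp only [hg, hY]
    abel
  obtain ⟨D, hD⟩ := hD.const_of_ae_hasDerivAt_zero hD0
  have e0 := hD 0 left_mem_uIcc
  have et := hD t right_mem_uIcc
  have hgX : ∫ s in (0 : ℝ)..t, (φ' s • X s + φ s • f s) = ∫ s in (0 : ℝ)..t, g s := by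
    refine intervalIntegral.integral_congr fun s hs => ?_
    rw [uIcc_of_le ht] at hs
    simp only [hg, hY, hX s hs]
  rw [hgX, hX t ⟨ht, le_rfl⟩]
  simp only [hY, intervalIntegral.integral_same, add_zero, sub_zero] at e0 et
  rw [e0, ← et]
  abel

theorem IsControl.of_norm_le {m : ℕ} {u : ℝ → EuclideanSpace ℝ (Fin m)} {c : ℝ}
    (hu : AEMeasurable u (volume.restrict (Ici 0))) (hc : ∀ t, 0 ≤ t → ‖u t‖ ≤ c) :
    IsControl u :=
  ⟨hu, fun _ => ⟨c, (ae_restrict_mem measurableSet_Icc).mono fun t ht => hc t ht.1⟩⟩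

theorem norm_prodMk_clm_le {E F : Type*} [NormedAddCommGroup E] [NormedSpace ℝ E]
    [NormedAddCommGroup F] [NormedSpace ℝ F] (G : E →L[ℝ] F) (y : E) :
    ‖(y, G y)‖ ≤ (1 + ‖G‖) * ‖y‖ := by
  refine max_le ?_ ((G.le_opNorm y).trans ?_)
  · nlinarith [norm_nonneg G, norm_nonneg y]
  · nlinarith [norm_nonneg G, norm_nonneg y]

namespace ControlProblem

variable {n m : ℕ}

namespace IsLinearQuadratic

variable {P : ControlProblem n m} {A : EuclideanSpace ℝ (Fin n) →L[ℝ] EuclideanSpace ℝ (Fin n)}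
  {B : EuclideanSpace ℝ (Fin m) →L[ℝ] EuclideanSpace ℝ (Fin n)} {c₁ c₂ : ℝ}
  {u : ℝ → EuclideanSpace ℝ (Fin m)} {x : ℝ → EuclideanSpace ℝ (Fin n)}
  {x₀ : EuclideanSpace ℝ (Fin n)}
  {G : EuclideanSpace ℝ (Fin n) →L[ℝ] EuclideanSpace ℝ (Fin m)} {κ ω : ℝ}

theorem VInf_le_of_exp_decay (hP : P.IsLinearQuadratic A B c₁ c₂)
    (hux : P.IsAdmissiblePair (Ici 0) x₀ u x) {a d : ℝ} (ha : 0 < a)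
    (hd : ∀ t, 0 ≤ t → ‖(x t, u t)‖ ≤ d * Real.exp (-(a * t))) :
    P.VInf x₀ ≤ ENNReal.ofReal (c₂ * d ^ 2 / (2 * a)) := by
  have h1 : P.VInf x₀ ≤ P.cost (Ici 0) u x := value_le_cost hux
  have h2 : P.cost (Ici 0) u x ≤
      ∫⁻ t in Ici (0 : ℝ), ENNReal.ofReal (c₂ * d ^ 2 * Real.exp (-(2 * a) * t)) := by
    refine setLIntegral_mono (by fun_prop) fun t ht => ENNReal.ofReal_le_ofReal ?_
    have hc := hP.c₂_pos
    calc P.ℓ (x t) (u t) ≤ c₂ * ‖(x t, u t)‖ ^ 2 := hP.ell_le _ _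
      _ ≤ c₂ * (d * Real.exp (-(a * t))) ^ 2 := by gcongr; exact hd t ht
      _ = _ := by rw [mul_pow, ← Real.exp_nat_mul, mul_assoc]; congr 3; push_cast; ring
  have hneg : -(2 * a) < 0 := by linarith
  have hint : IntegrableOn (fun t => c₂ * d ^ 2 * Real.exp (-(2 * a) * t)) (Ioi 0) :=
    (integrableOn_exp_mul_Ioi hneg 0).const_mul _
  have hc := hP.c₂_pos
  rw [← restrict_Ioi_eq_restrict_Ici, ← ofReal_integral_eq_lintegral_ofReal hint
    (Eventually.of_forall fun t => by positivity), integral_const_mul,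
    integral_exp_mul_Ioi hneg] at h2
  refine (h1.trans h2).trans_eq ?_
  congr 1
  simp
  ring

/-- Local cost controllability: near the origin the linear feedback `u = G x` satisfies the
constraints, and its cost is quadratic in the initial value. -/
theorem exists_a2 (hP : P.IsLinearQuadratic A B c₁ c₂) (hκ : 0 < κ) (hω : 0 < ω)
    (hG : ∀ t : ℝ, 0 ≤ t → ‖NormedSpace.exp (t • (A + B ∘L G))‖ ≤ κ * Real.exp (-(ω * t))) :
    ∃ γ W, P.A2 γ W := by
  obtain ⟨r, hr, hrE⟩ := hP.exists_ball_subset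
  have hc₁ := hP.c₁_pos
  have hc₂ := hP.c₂_pos
  set d := (1 + ‖G‖) * κ with hd
  have hd0 : 0 < d := by positivity
  refine ⟨c₂ * d ^ 2 / (2 * ω) / c₁, Metric.ball 0 (r / d), by positivity,
    Metric.ball_mem_nhds _ (by positivity), ?_⟩
  rintro x₀ ⟨hx₀, hx₀X⟩
  rw [mem_ball_zero_iff, lt_div_iff₀ hd0] at hx₀
  set x : ℝ → EuclideanSpace ℝ (Fin n) := fun t => NormedSpace.exp (t • (A + B ∘L G)) x₀ with hx
  have hderiv : ∀ t, HasDerivAt x (A (x t) + B (G (x t))) t := fun t => by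
    have h := (hasDerivAt_exp_smul_const' (𝕂 := ℝ) (A + B ∘L G) t).clm_apply
      (hasDerivAt_const t x₀)
    simpa [hx] using h
  have hxc : Continuous x := continuous_iff_continuousAt.2 fun t => (hderiv t).continuousAt
  have hbound : ∀ t, 0 ≤ t → ‖(x t, G (x t))‖ ≤ d * ‖x₀‖ * Real.exp (-(ω * t)) := by
    intro t ht
    calc ‖(x t, G (x t))‖ ≤ (1 + ‖G‖) * ‖x t‖ := norm_prodMk_clm_le _ _
      _ ≤ (1 + ‖G‖) * (κ * Real.exp (-(ω * t)) * ‖x₀‖) := by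
        gcongr
        exact ContinuousLinearMap.le_of_opNorm_le _ (hG t ht) _
      _ = _ := by rw [hd]; ring
  have hbound' : ∀ t, 0 ≤ t → ‖(x t, G (x t))‖ ≤ r := by
    intro t ht
    have : Real.exp (-(ω * t)) ≤ 1 := Real.exp_le_one_iff.2 (by nlinarith)
    calc _ ≤ d * ‖x₀‖ * Real.exp (-(ω * t)) := hbound t ht
      _ ≤ d * ‖x₀‖ * 1 := by gcongr
      _ ≤ r := by linarith
  have hadm : P.IsAdmissiblePair (Ici 0) x₀ (fun t => G (x t)) x := by
    refine ⟨IsControl.of_norm_le (c := r) (G.continuous.comp hxc).measurable.aemeasurable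
      fun t ht => (norm_snd_le (x t, G (x t))).trans (hbound' t ht),
      ⟨hxc.continuousOn, fun t _ => ?_⟩, fun t ht => hrE _ (hbound' t ht)⟩
    simp_rw [hP.f_eq]
    rw [intervalIntegral.integral_eq_sub_of_hasDerivAt (fun s _ => hderiv s)
      (Continuous.intervalIntegrable (by fun_prop) _ _)]
    have h0 : x 0 = x₀ := by
      simp only [hx]
      rw [zero_smul ℝ (A + B ∘L G), NormedSpace.exp_zero, one_apply_eq_self]
    rw [h0, add_sub_cancel]
  refine (hP.VInf_le_of_exp_decay hadm hω hbound).trans (ENNReal.ofReal_le_ofReal ?_)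
  calc c₂ * (d * ‖x₀‖) ^ 2 / (2 * ω) = c₂ * d ^ 2 / (2 * ω) / c₁ * (c₁ * ‖x₀‖ ^ 2) := by
        field_simp
    _ ≤ _ := by gcongr; exact hP.mul_sq_le_ellStar hx₀X

/-- The response to a decaying disturbance `h` of the closed loop under a stabilising feedback, given
by the variation of constants formula. Its size is proportional to the factor `ε`. -/
theorem exists_forced_response (hω : 0 < ω) (hκ : 0 < κ)
    {H : EuclideanSpace ℝ (Fin n) →L[ℝ] EuclideanSpace ℝ (Fin n)}
    (hH : ∀ t : ℝ, 0 ≤ t → ‖NormedSpace.exp (t • H)‖ ≤ κ * Real.exp (-(ω * t)))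
    {h : ℝ → EuclideanSpace ℝ (Fin n)} (hh : Continuous h) {ε R : ℝ} (hε : 0 < ε)
    (hεω : 2 * ε ≤ ω) (hR : 0 ≤ R)
    (hhR : ∀ t, 0 ≤ t → ‖h t‖ ≤ ε * R * Real.exp (-(ε * t))) :
    ∃ e : ℝ → EuclideanSpace ℝ (Fin n), e 0 = 0 ∧ (∀ t, HasDerivAt e (H (e t) + h t) t) ∧
      ∀ t, 0 ≤ t → ‖e t‖ ≤ 2 * κ * R / ω * ε * Real.exp (-(ε * t)) := by
  set Φ : ℝ → EuclideanSpace ℝ (Fin n) →L[ℝ] EuclideanSpace ℝ (Fin n) :=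
    fun t => NormedSpace.exp (t • H) with hΦ
  have hΦd : ∀ t, HasDerivAt Φ (H * Φ t) t := fun t => hasDerivAt_exp_smul_const' (𝕂 := ℝ) H t
  have hΦc : Continuous Φ := continuous_iff_continuousAt.2 fun t => (hΦd t).continuousAt
  have hΦadd : ∀ s t, Φ (s + t) = Φ s * Φ t := exp_add_smul H
  have hΦ0 : Φ 0 = 1 := by
    simp only [hΦ]
    rw [zero_smul ℝ H, NormedSpace.exp_zero]
  have hkc : Continuous fun s => Φ (-s) (h s) := by fun_prop
  set e : ℝ → EuclideanSpace ℝ (Fin n) := fun t => Φ t (∫ s in (0 : ℝ)..t, Φ (-s) (h s)) with he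
  refine ⟨e, by simp [he], fun t => ?_, fun t ht => ?_⟩
  · have h1 := (hΦd t).clm_apply (intervalIntegral.integral_hasDerivAt_right
      (hkc.intervalIntegrable 0 t) (hkc.stronglyMeasurableAtFilter _ _) hkc.continuousAt)
    have h2 : Φ t (Φ (-t) (h t)) = h t := by
      have := hΦadd t (-t)
      rw [add_neg_cancel, hΦ0] at this
      exact (congrArg (fun L => L (h t)) this).symm
    rw [h2] at h1
    exact h1
  · have h1 : e t = ∫ s in (0 : ℝ)..t, Φ (t - s) (h s) := by
      simp only [he]
      rw [← ContinuousLinearMap.intervalIntegral_comp_comm _ (hkc.intervalIntegrable 0 t)]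
      refine intervalIntegral.integral_congr fun s _ => ?_
      simp only [sub_eq_add_neg, hΦadd]
      rfl
    have hq : 0 < ω - ε := by linarith
    have hd : ∀ s, HasDerivAt (fun s => κ * ε * R * Real.exp (-(ω * t)) / (ω - ε) *
        Real.exp ((ω - ε) * s)) (κ * ε * R * Real.exp (-(ω * t)) * Real.exp ((ω - ε) * s)) s := by
      intro s
      have := (((hasDerivAt_id s).const_mul (ω - ε)).exp).const_mul
        (κ * ε * R * Real.exp (-(ω * t)) / (ω - ε))
      convert! this using 1
      simp only [id]
      field_simp
    have h2 : ‖e t‖ ≤ ∫ s in (0 : ℝ)..t,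
        κ * ε * R * Real.exp (-(ω * t)) * Real.exp ((ω - ε) * s) := by
      rw [h1]
      refine intervalIntegral.norm_integral_le_of_norm_le ht (Eventually.of_forall fun s hs => ?_)
        (Continuous.intervalIntegrable (by fun_prop) _ _)
      calc ‖Φ (t - s) (h s)‖ ≤ κ * Real.exp (-(ω * (t - s))) * (ε * R * Real.exp (-(ε * s))) :=
            ContinuousLinearMap.le_of_opNorm_le_of_le _ (hH _ (by linarith [hs.2])) (hhR s hs.1.le)
        _ = κ * ε * R * (Real.exp (-(ω * (t - s))) * Real.exp (-(ε * s))) := by ring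
        _ = κ * ε * R * (Real.exp (-(ω * t)) * Real.exp ((ω - ε) * s)) := by
            rw [← Real.exp_add, ← Real.exp_add]; congr 2; ring
        _ = _ := by ring
    rw [intervalIntegral.integral_eq_sub_of_hasDerivAt (fun s _ => hd s)
      (Continuous.intervalIntegrable (by fun_prop) _ _)] at h2
    calc ‖e t‖ ≤ κ * ε * R * Real.exp (-(ω * t)) / (ω - ε) * Real.exp ((ω - ε) * t) :=
          h2.trans (sub_le_self _ (by positivity))
      _ = κ * ε * R / (ω - ε) * (Real.exp (-(ω * t)) * Real.exp ((ω - ε) * t)) := by ring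
      _ = κ * ε * R / (ω - ε) * Real.exp (-(ε * t)) := by
          rw [← Real.exp_add]; congr 2; ring
      _ ≤ κ * ε * R / (ω / 2) * Real.exp (-(ε * t)) := by gcongr; linarith
      _ = _ := by ring

/-- If `x₀ / ρ` is viable for some `ρ < 1`, then the scaled trajectory from `x₀` leaves a margin in
the constraints. Damping it by the factor `exp (-ε t)` and absorbing the resulting disturbance by the
stabilising feedback gives an admissible trajectory that decays exponentially, with constants that
do not depend on `x₀`. -/
theorem exists_VInf_le_of_scaled (hP : P.IsLinearQuadratic A B c₁ c₂) (hκ : 0 < κ) (hω : 0 < ω)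
    (hG : ∀ t : ℝ, 0 ≤ t → ‖NormedSpace.exp (t • (A + B ∘L G))‖ ≤ κ * Real.exp (-(ω * t)))
    {ρ : ℝ} (hρ : 0 < ρ) (hρ1 : ρ < 1) :
    ∃ C > 0, ∀ x₀, ρ⁻¹ • x₀ ∈ P.viabilityKernel → P.VInf x₀ ≤ ENNReal.ofReal C := by
  obtain ⟨r, hr, hrE⟩ := hP.exists_ball_subset
  obtain ⟨R, hR, hRE⟩ := hP.exists_norm_le
  have hc₂ := hP.c₂_pos
  have h1ρ : 0 < 1 - ρ := by linarith
  -- the damping rate, so small that the feedback term stays within the margin `(1 - ρ) r`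
  set ε := min (ω / 2) ((1 - ρ) * r / ((1 + ‖G‖) * (2 * κ * R / ω))) with hεdef
  have hε : 0 < ε := by positivity
  have hεω : 2 * ε ≤ ω := by
    have h := min_le_left (ω / 2) ((1 - ρ) * r / ((1 + ‖G‖) * (2 * κ * R / ω)))
    rw [← hεdef] at h
    linarith
  have hεr : (1 + ‖G‖) * (2 * κ * R / ω) * ε ≤ (1 - ρ) * r := by
    have h := min_le_right (ω / 2) ((1 - ρ) * r / ((1 + ‖G‖) * (2 * κ * R / ω)))
    rw [← hεdef, le_div_iff₀ (by positivity)] at h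
    linarith
  refine ⟨c₂ * R ^ 2 / (2 * ε), by positivity, ?_⟩
  rintro x₀ ⟨v, y, hv, hy, hE⟩
  have hyR : ∀ t, 0 ≤ t → ‖y t‖ ≤ R := fun t ht =>
    (norm_fst_le (y t, v t)).trans (hRE _ (hE t ht))
  set φ : ℝ → ℝ := fun t => ρ * Real.exp (-(ε * t)) with hφ
  have hφd : ∀ t, HasDerivAt φ (-(ε * φ t)) t := by
    intro t
    have := (((hasDerivAt_id t).const_mul ε).neg.exp).const_mul ρ
    convert! this using 1
    simp only [hφ, id, Pi.neg_apply]
    ring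
  have hφc : Continuous φ := by fun_prop
  have hφ0 : ∀ t, 0 < φ t := fun t => by positivity
  have hyc : Continuous fun t => y (max t 0) :=
    hy.1.comp_continuous (by fun_prop) fun t => mem_Ici.2 (le_max_right _ _)
  have hhc : Continuous fun t => (ε * φ t) • y (max t 0) :=
    (continuous_const.mul hφc).smul hyc
  obtain ⟨e, he0, hed, heb⟩ := exists_forced_response hω hκ hG
    (h := fun t => (ε * φ t) • y (max t 0)) hhc hε hεω hR.le (by
      intro t ht
      rw [norm_smul, Real.norm_of_nonneg (by have := hφ0 t; positivity), max_eq_left ht]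
      calc ε * φ t * ‖y t‖ ≤ ε * φ t * R := by
            have := hφ0 t; gcongr; exact hyR t ht
        _ = ρ * (ε * R * Real.exp (-(ε * t))) := by simp only [hφ]; ring
        _ ≤ 1 * (ε * R * Real.exp (-(ε * t))) := by gcongr
        _ = _ := one_mul _)
  have hec : Continuous e := continuous_iff_continuousAt.2 fun t => (hed t).continuousAt
  have hrhs : Continuous fun t => (A + B ∘L G) (e t) + (ε * φ t) • y (max t 0) :=
    ((A + B ∘L G).continuous.comp hec).add hhc
  set x : ℝ → EuclideanSpace ℝ (Fin n) := fun t => φ t • y t + e t with hx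
  set u : ℝ → EuclideanSpace ℝ (Fin m) := fun t => φ t • v t + G (e t) with hu
  have hmem : ∀ t, 0 ≤ t → ∃ z ∈ P.E, (x t, u t) = Real.exp (-(ε * t)) • z := by
    intro t ht
    set s := Real.exp (-(ε * t)) with hs
    have hs0 : 0 < s := Real.exp_pos _
    set w : EuclideanSpace ℝ (Fin n) × EuclideanSpace ℝ (Fin m) :=
      ((1 - ρ) * s)⁻¹ • (e t, G (e t)) with hw
    have hwE : w ∈ P.E := by
      refine hrE w ?_
      rw [hw, norm_smul, norm_inv, Real.norm_of_nonneg (by positivity), inv_mul_le_iff₀ (by positivity)]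
      calc ‖(e t, G (e t))‖ ≤ (1 + ‖G‖) * ‖e t‖ := norm_prodMk_clm_le _ _
        _ ≤ (1 + ‖G‖) * (2 * κ * R / ω * ε * s) := by gcongr; exact heb t ht
        _ = (1 + ‖G‖) * (2 * κ * R / ω) * ε * s := by ring
        _ ≤ (1 - ρ) * r * s := by gcongr
        _ = _ := by ring
    refine ⟨ρ • (y t, v t) + (1 - ρ) • w, hP.convex_E (hE t ht) hwE hρ.le h1ρ.le (by ring), ?_⟩
    rw [smul_add, smul_smul, smul_smul, hw, smul_smul]
    have h1 : s * (1 - ρ) * ((1 - ρ) * s)⁻¹ = 1 := by field_simp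
    rw [h1, one_smul]
    simp only [hx, hu, hφ, ← hs, Prod.smul_mk, Prod.mk_add_mk, mul_comm s ρ]
  have hbound : ∀ t, 0 ≤ t → ‖(x t, u t)‖ ≤ R * Real.exp (-(ε * t)) := by
    intro t ht
    obtain ⟨z, hz, h⟩ := hmem t ht
    rw [h, norm_smul, Real.norm_of_nonneg (Real.exp_pos _).le, mul_comm]
    gcongr
    exact hRE z hz
  have hxE : ∀ t, 0 ≤ t → (x t, u t) ∈ P.E := by
    intro t ht
    obtain ⟨z, hz, h⟩ := hmem t ht
    rw [h]
    exact hP.convex_E.smul_mem_of_zero_mem hP.zero_mem_E hz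
      ⟨(Real.exp_pos _).le, Real.exp_le_one_iff.2 (by nlinarith)⟩
  have huc : IsControl u := by
    refine IsControl.of_norm_le (c := R) ?_ fun t ht =>
      (norm_snd_le (x t, u t)).trans (hRE _ (hxE t ht))
    exact (hφc.measurable.aemeasurable.smul hv.1).add
      (G.continuous.comp hec).measurable.aemeasurable
  have hsol : P.IsSolution (Ici 0) x₀ u x := by
    refine ⟨(hφc.continuousOn.smul hy.1).add hec.continuousOn, fun t ht => ?_⟩
    have ht : 0 ≤ t := ht
    have hyt : ContinuousOn y (Icc 0 t) := hy.1.mono Icc_subset_Ici_self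
    have h0t : (0 : ℝ) ∈ Icc 0 t := ⟨le_rfl, ht⟩
    have htt : t ∈ Icc 0 t := ⟨ht, le_rfl⟩
    have hfint := hP.intervalIntegrable_f hv hyt h0t htt
    have h1 := smul_primitive_eq_integral (c := ‖A.coprod B‖ * R) ht hfint
      (fun s hs => by
        rw [hP.f_eq_coprod]
        exact (A.coprod B).le_of_opNorm_le_of_le le_rfl (hRE _ (hE s hs.1))) hφd (by fun_prop)
      (fun s hs => hy.2 s hs.1)
    have h2 : e t = ∫ s in (0 : ℝ)..t, ((A + B ∘L G) (e s) + (ε * φ s) • y (max s 0)) := by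
      rw [intervalIntegral.integral_eq_sub_of_hasDerivAt (fun s _ => hed s)
        (hrhs.intervalIntegrable _ _), he0, sub_zero]
    have h3 : φ 0 • ρ⁻¹ • x₀ = x₀ := by
      simp only [hφ, mul_zero, neg_zero, Real.exp_zero, mul_one]
      rw [smul_smul, mul_inv_cancel₀ hρ.ne', one_smul]
    simp only [hx]
    rw [h1, h2, h3, add_assoc, ← intervalIntegral.integral_add]
    · congr 1
      refine intervalIntegral.integral_congr fun s hs => ?_
      rw [uIcc_of_le ht] at hs
      simp only [hP.f_eq, max_eq_left hs.1, hu, map_add, map_smul, add_apply,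
        ContinuousLinearMap.comp_apply, smul_add, neg_smul]
      abel
    · refine IntervalIntegrable.add ?_ (hfint.continuousOn_smul hφc.continuousOn)
      refine ContinuousOn.intervalIntegrable ?_
      rw [uIcc_of_le ht]
      exact (continuous_const.mul hφc).neg.continuousOn.smul hyt
    · exact hrhs.intervalIntegrable _ _
  exact hP.VInf_le_of_exp_decay ⟨huc, hsol, fun t ht => hxE t ht⟩ hε hbound

/-- The infinite-horizon value function is bounded on compact subsets of the interior of the
viability kernel, because such a set stays in the viability kernel under a slight dilation. -/
theorem exists_VInf_le_on_compact (hP : P.IsLinearQuadratic A B c₁ c₂) (hκ : 0 < κ) (hω : 0 < ω)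
    (hG : ∀ t : ℝ, 0 ≤ t → ‖NormedSpace.exp (t • (A + B ∘L G))‖ ≤ κ * Real.exp (-(ω * t)))
    {K : Set (EuclideanSpace ℝ (Fin n))} (hK : IsCompact K)
    (hKA : K ⊆ interior P.viabilityKernel) :
    ∃ C > 0, ∀ x₀ ∈ K, P.VInf x₀ ≤ ENNReal.ofReal C := by
  have hev : ∀ᶠ s : ℝ in 𝓝 1, ∀ x ∈ K, s⁻¹ • x ∈ interior P.viabilityKernel := by
    refine hK.eventually_forall_of_forall_eventually fun x hx => ?_
    have hc : ContinuousAt (fun q : ℝ × EuclideanSpace ℝ (Fin n) => q.1⁻¹ • q.2) (1, x) := by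
      refine ContinuousAt.smul (ContinuousAt.inv₀ continuousAt_fst one_ne_zero) continuousAt_snd
    refine hc.eventually (IsOpen.mem_nhds isOpen_interior ?_)
    simpa using hKA hx
  have hev' : ∀ᶠ s : ℝ in 𝓝[<] 1, ∀ x ∈ K, s⁻¹ • x ∈ interior P.viabilityKernel :=
    nhdsWithin_le_nhds hev
  obtain ⟨ρ, hρK, hρ⟩ := (hev'.and (Ioo_mem_nhdsLT zero_lt_one)).exists
  obtain ⟨C, hC, h⟩ := hP.exists_VInf_le_of_scaled hκ hω hG hρ.1 hρ.2
  exact ⟨C, hC, fun x hx => h x (interior_subset (hρK x hx))⟩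

end IsLinearQuadratic
end ControlProblem

/-! ### Concatenation of trajectories -/

theorem intervalIntegral_of_eq_shift {E : Type*} [NormedAddCommGroup E] [NormedSpace ℝ E]
    {F G : ℝ → E} {p q a : ℝ} (hpq : p ≤ q) (h : ∀ s ∈ Ico p q, F s = G (s + a))
    (hG : IntervalIntegrable G volume (p + a) (q + a)) :
    IntervalIntegrable F volume p q ∧ ∫ s in p..q, F s = ∫ s in (p + a)..(q + a), G s := by
  have hEq : EqOn F (fun s => G (s + a)) (Ioo p q) := fun s hs => h s (Ioo_subset_Ico_self hs)
  refine ⟨?_, ?_⟩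
  · refine IntervalIntegrable.congr_uIoo (f := fun s => G (s + a)) ?_ ?_
    · exact (IntervalIntegrable.comp_add_right_iff (f := G)).2 hG
    · rw [uIoo_of_le hpq]
      exact hEq.symm
  · rw [intervalIntegral.integral_congr_Ioo_of_le hpq hEq,
      intervalIntegral.integral_comp_add_right]

theorem aemeasurable_comp_add_right {E : Type*} [MeasurableSpace E] {u : ℝ → E}
    (hu : AEMeasurable u (volume.restrict (Ici 0))) (a : ℝ) :
    AEMeasurable (fun s => u (s + a)) (volume.restrict (Ici (-a))) := by
  have h := (measurePreserving_add_right (volume : Measure ℝ) a).restrict_preimage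
    (measurableSet_Ici (a := (0 : ℝ)))
  have h2 : (fun s : ℝ => s + a) ⁻¹' Ici 0 = Ici (-a) := by
    ext s; simp [neg_le_iff_add_nonneg]
  rw [h2] at h
  exact hu.comp_quasiMeasurePreserving h.quasiMeasurePreserving

theorem setLIntegral_comp_add_right (F : ℝ → ℝ≥0∞) (a p q : ℝ) :
    ∫⁻ s in Icc p q, F (s + a) = ∫⁻ s in Icc (p + a) (q + a), F s := by
  have h := (measurePreserving_add_right (volume : Measure ℝ) a).setLIntegral_comp_preimage_emb
    (measurableEmbedding_addRight a) F (Icc (p + a) (q + a))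
  rwa [preimage_add_const_Icc, add_sub_cancel_right, add_sub_cancel_right] at h

theorem setLIntegral_Ici_comp_add_right (F : ℝ → ℝ≥0∞) (a p : ℝ) :
    ∫⁻ s in Ici p, F (s + a) = ∫⁻ s in Ici (p + a), F s := by
  have h := (measurePreserving_add_right (volume : Measure ℝ) a).setLIntegral_comp_preimage_emb
    (measurableEmbedding_addRight a) F (Ici (p + a))
  rwa [preimage_add_const_Ici, add_sub_cancel_right] at h

namespace ControlProblem

variable {n m : ℕ} {P : ControlProblem n m}

theorem isSolution_Ici {x₀ : EuclideanSpace ℝ (Fin n)} {u : ℝ → EuclideanSpace ℝ (Fin m)}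
    {x : ℝ → EuclideanSpace ℝ (Fin n)}
    (hint : ∀ t, 0 ≤ t → IntervalIntegrable (fun s => P.f (x s) (u s)) volume 0 t)
    (hx : ∀ t, 0 ≤ t → x t = x₀ + ∫ s in (0 : ℝ)..t, P.f (x s) (u s)) :
    P.IsSolution (Ici 0) x₀ u x := by
  refine ⟨fun t ht => ?_, hx⟩
  have ht : 0 ≤ t := ht
  have ht1 : (0 : ℝ) ≤ t + 1 := by linarith
  have h1 := intervalIntegral.continuousOn_primitive_interval' (hint (t + 1) ht1)
    (left_mem_uIcc)
  rw [uIcc_of_le ht1] at h1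
  have h2 : ContinuousOn x (Icc 0 (t + 1)) :=
    (continuousOn_const.add h1).congr fun s hs => hx s hs.1
  refine (h2 t ⟨ht, by linarith⟩).mono_of_mem_nhdsWithin ?_
  rw [← Ici_inter_Iic]
  exact inter_mem_nhdsWithin _ (Iic_mem_nhds (by linarith))

theorem V_le_VInf (T : ℝ) (x₀ : EuclideanSpace ℝ (Fin n)) : P.V T x₀ ≤ P.VInf x₀ := by
  refine le_iInf fun u => le_iInf fun x => le_iInf fun h => ?_
  refine (value_le_cost (h.mono Icc_subset_Ici_self)).trans ?_
  exact lintegral_mono_set Icc_subset_Ici_self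

namespace IsLinearQuadratic

variable {A : EuclideanSpace ℝ (Fin n) →L[ℝ] EuclideanSpace ℝ (Fin n)}
  {B : EuclideanSpace ℝ (Fin m) →L[ℝ] EuclideanSpace ℝ (Fin n)} {c₁ c₂ : ℝ}
  {u : ℝ → EuclideanSpace ℝ (Fin m)} {x : ℝ → EuclideanSpace ℝ (Fin n)}
  {x₀ : EuclideanSpace ℝ (Fin n)} {T : ℝ}

/-- One half of the dynamic programming principle: following an admissible trajectory on `[a, b]`
and continuing with any admissible trajectory on the infinite horizon is admissible. -/
theorem VInf_le_lintegral_add (hP : P.IsLinearQuadratic A B c₁ c₂)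
    (hux : P.IsAdmissiblePair (Icc 0 T) x₀ u x) {a b : ℝ} (ha : 0 ≤ a) (hab : a ≤ b)
    (hb : b ≤ T) :
    P.VInf (x a) ≤ (∫⁻ s in Icc a b, ENNReal.ofReal (P.ℓ (x s) (u s))) + P.VInf (x b) := by
  obtain ⟨R, hR, hRE⟩ := hP.exists_norm_le
  obtain ⟨hu, hx, hE⟩ := hux
  rw [← tsub_le_iff_left]
  refine le_iInf fun v => le_iInf fun y => le_iInf fun ⟨hv, hy, hvE⟩ => ?_
  rw [tsub_le_iff_left]
  set d := b - a with hd
  have hd0 : 0 ≤ d := by linarith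
  set w : ℝ → EuclideanSpace ℝ (Fin m) := fun s => if s < d then u (s + a) else v (s + -d) with hw
  set z : ℝ → EuclideanSpace ℝ (Fin n) := fun s => if s < d then x (s + a) else y (s + -d) with hz
  have haT : a ∈ Icc 0 T := ⟨ha, hab.trans hb⟩
  have hbT : b ∈ Icc 0 T := ⟨ha.trans hab, hb⟩
  have hzE : ∀ t, 0 ≤ t → (z t, w t) ∈ P.E := by
    intro t ht
    by_cases h : t < d
    · simpa only [hz, hw, if_pos h] using hE (t + a) ⟨by linarith, by linarith⟩
    · simpa only [hz, hw, if_neg h] using hvE (t + -d) (mem_Ici.2 (by linarith))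
  have hwc : IsControl w := by
    refine IsControl.of_norm_le (c := R) ?_ fun t ht =>
      (norm_snd_le (z t, w t)).trans (hRE _ (hzE t ht))
    rw [← Ico_union_Ici_eq_Ici hd0]
    refine aemeasurable_union_iff.2 ⟨?_, ?_⟩
    · refine ((aemeasurable_comp_add_right hu.1 a).mono_measure
        (Measure.restrict_mono (fun s hs => mem_Ici.2 (by linarith [hs.1])) le_rfl)).congr ?_
      filter_upwards [ae_restrict_mem measurableSet_Ico] with s hs
      simp only [hw, if_pos hs.2]
    · have h := aemeasurable_comp_add_right hv.1 (-d)
      rw [neg_neg] at h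
      refine h.congr ?_
      filter_upwards [ae_restrict_mem measurableSet_Ici] with s hs
      simp only [hw, if_neg (not_lt.2 (mem_Ici.1 hs))]
  have hfirst : ∀ t, 0 ≤ t → t ≤ d →
      IntervalIntegrable (fun s => P.f (z s) (w s)) volume 0 t ∧
        ∫ s in (0 : ℝ)..t, P.f (z s) (w s) = x (t + a) - x a := by
    intro t ht htd
    have htT : t + a ∈ Icc 0 T := ⟨by linarith, by linarith⟩
    have h := intervalIntegral_of_eq_shift (F := fun s => P.f (z s) (w s))
      (G := fun s => P.f (x s) (u s)) (a := a) ht (fun s hs => by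
        have : s < d := hs.2.trans_le htd
        simp only [hz, hw, if_pos this])
      (hP.intervalIntegrable_f hu hx.1 (by rwa [zero_add]) htT)
    refine ⟨h.1, h.2.trans ?_⟩
    rw [zero_add, hP.sub_eq_integral hu hx haT htT]
  have hsecond : ∀ t, d ≤ t →
      IntervalIntegrable (fun s => P.f (z s) (w s)) volume d t ∧
        x b + ∫ s in d..t, P.f (z s) (w s) = y (t + -d) := by
    intro t htd
    have h0 : (0 : ℝ) ≤ t + -d := by linarith
    have h := intervalIntegral_of_eq_shift (F := fun s => P.f (z s) (w s))
      (G := fun s => P.f (y s) (v s)) (a := -d) htd (fun s hs => by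
        have : ¬ s < d := not_lt.2 hs.1
        simp only [hz, hw, if_neg this])
      (hP.intervalIntegrable_f (T := t + -d) hv (hy.1.mono Icc_subset_Ici_self)
        ⟨by simp, by linarith⟩ ⟨h0, le_rfl⟩)
    refine ⟨h.1, ?_⟩
    rw [h.2, add_neg_cancel, ← hy.2 _ h0]
  have hda : d + a = b := by rw [hd]; ring
  have hadm : P.IsAdmissiblePair (Ici 0) (x a) w z := by
    refine ⟨hwc, isSolution_Ici (fun t ht => ?_) (fun t ht => ?_), fun t ht => hzE t ht⟩
    · rcases le_total t d with h | h
      · exact (hfirst t ht h).1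
      · exact (hfirst d hd0 le_rfl).1.trans (hsecond t h).1
    · rcases lt_or_ge t d with h | h
      · rw [(hfirst t ht h.le).2]
        simp only [hz, if_pos h]
        abel
      · rw [← intervalIntegral.integral_add_adjacent_intervals (hfirst d hd0 le_rfl).1
          (hsecond t h).1, (hfirst d hd0 le_rfl).2, hda]
        simp only [hz, if_neg (not_lt.2 h)]
        rw [← (hsecond t h).2]
        abel
  refine (value_le_cost hadm).trans ?_
  have hsplit : P.cost (Ici 0) w z =
      ∫⁻ s in Ico 0 d ∪ Ici d, ENNReal.ofReal (P.ℓ (z s) (w s)) := by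
    rw [Ico_union_Ici_eq_Ici hd0, cost]
  rw [hsplit]
  refine (lintegral_union_le _ _ _).trans (add_le_add ?_ (le_of_eq ?_))
  · calc ∫⁻ s in Ico 0 d, ENNReal.ofReal (P.ℓ (z s) (w s))
        = ∫⁻ s in Ico 0 d, ENNReal.ofReal (P.ℓ (x (s + a)) (u (s + a))) := by
          refine setLIntegral_congr_fun measurableSet_Ico fun s hs => ?_
          simp only [hz, hw, if_pos hs.2]
      _ ≤ ∫⁻ s in Icc 0 d, ENNReal.ofReal (P.ℓ (x (s + a)) (u (s + a))) :=
          lintegral_mono_set Ico_subset_Icc_self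
      _ = _ := by
          rw [setLIntegral_comp_add_right (fun s => ENNReal.ofReal (P.ℓ (x s) (u s))), zero_add,
            hda]
  · calc ∫⁻ s in Ici d, ENNReal.ofReal (P.ℓ (z s) (w s))
        = ∫⁻ s in Ici d, ENNReal.ofReal (P.ℓ (y (s + -d)) (v (s + -d))) := by
          refine setLIntegral_congr_fun measurableSet_Ici fun s hs => ?_
          simp only [hz, hw, if_neg (not_lt.2 (mem_Ici.1 hs))]
      _ = _ := by
          rw [setLIntegral_Ici_comp_add_right (fun s => ENNReal.ofReal (P.ℓ (y s) (v s))),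
            add_neg_cancel]
          rfl

end IsLinearQuadratic
end ControlProblem

/-! ### The value function along optimal trajectories -/

namespace ControlProblem

variable {n m : ℕ} {P : ControlProblem n m}

theorem beta_pos {C γ : ℝ} {W : Set (EuclideanSpace ℝ (Fin n))} (h : P.A2 γ W) :
    0 < P.beta C γ W :=
  h.1.trans_le (le_max_right _ _)

namespace IsLinearQuadratic

variable {A : EuclideanSpace ℝ (Fin n) →L[ℝ] EuclideanSpace ℝ (Fin n)}
  {B : EuclideanSpace ℝ (Fin m) →L[ℝ] EuclideanSpace ℝ (Fin n)} {c₁ c₂ : ℝ}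
  {u : ℝ → EuclideanSpace ℝ (Fin m)} {x : ℝ → EuclideanSpace ℝ (Fin n)}
  {x₀ : EuclideanSpace ℝ (Fin n)} {T C γ Cbar δ : ℝ} {W : Set (EuclideanSpace ℝ (Fin n))} {N : ℕ}

theorem intervalIntegrable_ell (hP : P.IsLinearQuadratic A B c₁ c₂)
    (hux : P.IsAdmissiblePair (Icc 0 T) x₀ u x) {a b : ℝ} (ha : a ∈ Icc 0 T) (hb : b ∈ Icc 0 T) :
    IntervalIntegrable (fun s => P.ℓ (x s) (u s)) volume a b :=
  ((hP.integrableOn_ell hux.1 hux.2.1.1).mono_set (uIcc_subset_Icc ha hb)).intervalIntegrable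

theorem lintegral_ell_eq (hP : P.IsLinearQuadratic A B c₁ c₂)
    (hux : P.IsAdmissiblePair (Icc 0 T) x₀ u x) {a b : ℝ} (ha : 0 ≤ a) (hab : a ≤ b) (hb : b ≤ T) :
    ∫⁻ s in Icc a b, ENNReal.ofReal (P.ℓ (x s) (u s)) =
      ENNReal.ofReal (∫ s in a..b, P.ℓ (x s) (u s)) := by
  rw [intervalIntegral.integral_of_le hab, ← integral_Icc_eq_integral_Ioc,
    ofReal_integral_eq_lintegral_ofReal ((hP.integrableOn_ell hux.1 hux.2.1.1).mono_set
      (Icc_subset_Icc ha hb)) (Eventually.of_forall fun s => hP.ell_nonneg _ _)]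

theorem integral_ell_nonneg (hP : P.IsLinearQuadratic A B c₁ c₂) {a b : ℝ} (hab : a ≤ b) :
    0 ≤ ∫ s in a..b, P.ℓ (x s) (u s) :=
  intervalIntegral.integral_nonneg hab fun _ _ => hP.ell_nonneg _ _

theorem integral_ell_add (hP : P.IsLinearQuadratic A B c₁ c₂)
    (hux : P.IsAdmissiblePair (Icc 0 T) x₀ u x) {a b c : ℝ} (ha : a ∈ Icc 0 T) (hb : b ∈ Icc 0 T)
    (hc : c ∈ Icc 0 T) : (∫ s in a..b, P.ℓ (x s) (u s)) + ∫ s in b..c, P.ℓ (x s) (u s) =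
      ∫ s in a..c, P.ℓ (x s) (u s) :=
  intervalIntegral.integral_add_adjacent_intervals (hP.intervalIntegrable_ell hux ha hb)
    (hP.intervalIntegrable_ell hux hb hc)

/-- The tail of an optimal trajectory costs no more than the infinite-horizon value at its start. -/
theorem ofReal_tail_le_VInf (hP : P.IsLinearQuadratic A B c₁ c₂)
    (hux : P.IsAdmissiblePair (Icc 0 T) x₀ u x) (hopt : P.cost (Icc 0 T) u x = P.V T x₀)
    {t : ℝ} (ht : t ∈ Icc 0 T) :
    ENNReal.ofReal (∫ s in t..T, P.ℓ (x s) (u s)) ≤ P.VInf (x t) := by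
  have h0 : (0 : ℝ) ∈ Icc 0 T := ⟨le_rfl, ht.1.trans ht.2⟩
  have hT : T ∈ Icc 0 T := ⟨ht.1.trans ht.2, le_rfl⟩
  have hx0 : x 0 = x₀ := by simpa using hux.2.1.2 0 h0
  have h1 := hP.VInf_le_lintegral_add hux le_rfl ht.1 ht.2
  rw [hx0, hP.lintegral_ell_eq hux le_rfl ht.1 ht.2] at h1
  have h2 := (V_le_VInf T x₀).trans h1
  rw [← hopt, cost, hP.lintegral_ell_eq hux le_rfl hT.1 le_rfl,
    ← hP.integral_ell_add hux h0 ht hT,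
    ENNReal.ofReal_add (hP.integral_ell_nonneg ht.1) (hP.integral_ell_nonneg ht.2)] at h2
  exact (ENNReal.add_le_add_iff_left ENNReal.ofReal_ne_top).1 h2

/-- Along an optimal trajectory of cost at most `C`, the cost to go is at most `β` times the minimal
stage cost: inside `W` by local cost controllability, outside because `C ≤ (C / M) ℓ⋆`. -/
theorem tail_le_beta_mul_ellStar (hP : P.IsLinearQuadratic A B c₁ c₂) (hA2 : P.A2 γ W)
    (hC : 0 ≤ C) (hux : P.IsAdmissiblePair (Icc 0 T) x₀ u x)
    (hopt : P.cost (Icc 0 T) u x = P.V T x₀) (hVC : P.V T x₀ ≤ ENNReal.ofReal C)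
    {t : ℝ} (ht : t ∈ Icc 0 T) :
    ∫ s in t..T, P.ℓ (x s) (u s) ≤ P.beta C γ W * P.ellStar (x t) := by
  have h0 : (0 : ℝ) ∈ Icc 0 T := ⟨le_rfl, ht.1.trans ht.2⟩
  have hT : T ∈ Icc 0 T := ⟨ht.1.trans ht.2, le_rfl⟩
  have hX : x t ∈ P.stateSet := ⟨u t, hux.2.2 t ht⟩
  have hl := hP.ellStar_nonneg hX
  by_cases hW : x t ∈ W
  · have h := (hP.ofReal_tail_le_VInf hux hopt ht).trans (hA2.2.2 _ ⟨hW, hX⟩)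
    have h1 := (ENNReal.ofReal_le_ofReal_iff (mul_nonneg hA2.1.le hl)).1 h
    exact h1.trans (mul_le_mul_of_nonneg_right (le_max_right _ _) hl)
  · have h1 : ∫ s in (0 : ℝ)..T, P.ℓ (x s) (u s) ≤ C := by
      rw [← hopt, cost, hP.lintegral_ell_eq hux le_rfl hT.1 le_rfl] at hVC
      exact (ENNReal.ofReal_le_ofReal_iff hC).1 hVC
    have h2 := hP.integral_ell_add hux h0 ht hT
    have h3 := hP.integral_ell_nonneg (x := x) (u := u) ht.1
    calc ∫ s in t..T, P.ℓ (x s) (u s) ≤ C := by linarith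
      _ ≤ P.ratio C W * P.ellStar (x t) := hP.le_ratio_mul_ellStar hA2.2.1 hX hW
      _ ≤ _ := mul_le_mul_of_nonneg_right (le_max_left _ _) hl

/-- The cost to go along an optimal trajectory decays geometrically over the sampling instants, by
integration of `J(t) ≤ β ℓ(x(t), u(t))` over one sampling period. -/
theorem tail_le_pow_mul (hP : P.IsLinearQuadratic A B c₁ c₂) (hA2 : P.A2 γ W)
    (hC : 0 ≤ C) (hδ : 0 < δ) (hux : P.IsAdmissiblePair (Icc 0 (N * δ)) x₀ u x)
    (hopt : P.cost (Icc 0 (N * δ)) u x = P.V (N * δ) x₀)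
    (hVC : P.V (N * δ) x₀ ≤ ENNReal.ofReal C) {k : ℕ} (hk : k ≤ N) :
    ∫ s in (k * δ)..(N * δ), P.ℓ (x s) (u s) ≤
      (P.beta C γ W / (P.beta C γ W + δ)) ^ k * ∫ s in (0 : ℝ)..(N * δ), P.ℓ (x s) (u s) := by
  have hβ : 0 < P.beta C γ W := beta_pos hA2
  set β := P.beta C γ W with hβdef
  have hgrid : ∀ j : ℕ, j ≤ N → (j * δ : ℝ) ∈ Icc 0 (N * δ) := fun j hj =>
    ⟨by positivity, by gcongr⟩
  induction k with
  | zero => simp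
  | succ k ih =>
    have ih := ih (Nat.le_of_succ_le hk)
    have hk1 := hgrid k (Nat.le_of_succ_le hk)
    have hk2 := hgrid (k + 1) hk
    have hkk : (k * δ : ℝ) ≤ (k + 1 : ℕ) * δ := by push_cast; nlinarith
    have hT := hgrid N le_rfl
    set J := ∫ s in ((k + 1 : ℕ) * δ)..(N * δ), P.ℓ (x s) (u s) with hJ
    have hsum := hP.integral_ell_add hux hk1 hk2 hT
    have hstep : δ * J ≤ β * ∫ s in (k * δ)..((k + 1 : ℕ) * δ), P.ℓ (x s) (u s) := by
      have h1 : ∫ s in (k * δ)..((k + 1 : ℕ) * δ), J ≤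
          ∫ s in (k * δ)..((k + 1 : ℕ) * δ), β * P.ℓ (x s) (u s) := by
        refine intervalIntegral.integral_mono_on hkk (by simp)
          ((hP.intervalIntegrable_ell hux hk1 hk2).const_mul _) fun s hs => ?_
        have hs' : s ∈ Icc 0 (N * δ) := ⟨hk1.1.trans hs.1, hs.2.trans hk2.2⟩
        have h2 := hP.integral_ell_add hux hs' hk2 hT
        have h3 := hP.integral_ell_nonneg (x := x) (u := u) hs.2
        calc J ≤ ∫ r in s..(N * δ), P.ℓ (x r) (u r) := by linarith
          _ ≤ β * P.ellStar (x s) := hP.tail_le_beta_mul_ellStar hA2 hC hux hopt hVC hs'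
          _ ≤ β * P.ℓ (x s) (u s) := by gcongr; exact hP.ellStar_le (hux.2.2 s hs')
      rw [intervalIntegral.integral_const, intervalIntegral.integral_const_mul] at h1
      have h4 : ((k + 1 : ℕ) * δ - k * δ : ℝ) = δ := by push_cast; ring
      rwa [h4, smul_eq_mul] at h1
    have h5 : J ≤ β / (β + δ) * ∫ s in (k * δ)..(N * δ), P.ℓ (x s) (u s) := by
      rw [div_mul_eq_mul_div, le_div_iff₀ (by positivity), ← hsum]
      linarith
    calc J ≤ β / (β + δ) * ∫ s in (k * δ)..(N * δ), P.ℓ (x s) (u s) := h5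
      _ ≤ β / (β + δ) * ((β / (β + δ)) ^ k * ∫ s in (0 : ℝ)..(N * δ), P.ℓ (x s) (u s)) := by
        gcongr
      _ = _ := by rw [pow_succ]; ring

theorem VInf_zero (hP : P.IsLinearQuadratic A B c₁ c₂) (hA2 : P.A2 γ W) : P.VInf 0 = 0 := by
  have h1 := hA2.2.2 0 ⟨mem_of_mem_nhds hA2.2.1, ⟨0, hP.zero_mem_E⟩⟩
  have h2 : P.ellStar 0 ≤ 0 := by
    simpa using (hP.ellStar_le hP.zero_mem_E).trans (hP.ell_le 0 0)
  rw [ENNReal.ofReal_of_nonpos (mul_nonpos_of_nonneg_of_nonpos hA2.1.le h2)] at h1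
  exact le_antisymm h1 zero_le

/-- The relaxed Lyapunov inequality. Some state `x(t̄)` of the optimal trajectory in the last sampling
period has a stage cost so small that it lies in `W`; continuing from there with the infinite-horizon
bound of local cost controllability costs at most the fraction `α` of the cost over the first sampling
period. -/
theorem V_add_le_V (hP : P.IsLinearQuadratic A B c₁ c₂) (hA2 : P.A2 γ W)
    (hA3 : P.A3 (N * δ) C Cbar) (hH : P.HorizonCondition C γ W Cbar δ N) (hC : 0 < C)
    (hδ : 0 < δ) (hx₀ : x₀ ∈ P.sublevel (N * δ) C)
    (hux : P.IsAdmissiblePair (Icc 0 (N * δ)) x₀ u x)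
    (hopt : P.cost (Icc 0 (N * δ)) u x = P.V (N * δ) x₀) :
    P.V (N * δ) (x δ) + ENNReal.ofReal (1 - Cbar * (P.beta C γ W / δ) ^ 2 *
      (P.beta C γ W / (P.beta C γ W + δ)) ^ (N - 1)) * P.cost (Icc 0 δ) u x ≤ P.V (N * δ) x₀ := by
  obtain ⟨hN1, hN2, hmax⟩ := hH
  have hN : (1 : ℝ) ≤ N := by exact_mod_cast hN1
  have hβ : 0 < P.beta C γ W := beta_pos hA2
  have hγβ : γ ≤ P.beta C γ W := le_max_right _ _
  have hCb := hA3.1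
  have hγ := hA2.1
  have hδT : δ ≤ N * δ := by nlinarith
  have h0m : (0 : ℝ) ∈ Icc 0 (N * δ) := ⟨le_rfl, by linarith⟩
  have hδm : δ ∈ Icc 0 (N * δ) := ⟨hδ.le, hδT⟩
  have hTm : N * δ ∈ Icc 0 (N * δ) := ⟨by linarith, le_rfl⟩
  have hx0 : x 0 = x₀ := by simpa using hux.2.1.2 0 h0m
  set q := (P.beta C γ W / (P.beta C γ W + δ)) ^ (N - 1) with hq
  have hq0 : 0 < q := by positivity
  set I := ∫ s in (0 : ℝ)..δ, P.ℓ (x s) (u s) with hI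
  set J := ∫ s in (0 : ℝ)..(N * δ), P.ℓ (x s) (u s) with hJ
  have hI0 : 0 ≤ I := hP.integral_ell_nonneg hδ.le
  have hcostI : P.cost (Icc 0 δ) u x = ENNReal.ofReal I :=
    hP.lintegral_ell_eq hux le_rfl hδ.le hδT
  have hVJ : P.V (N * δ) x₀ = ENNReal.ofReal J :=
    hopt.symm.trans (hP.lintegral_ell_eq hux le_rfl hTm.1 le_rfl)
  have hJ0 : 0 ≤ J := hP.integral_ell_nonneg hTm.1
  have hJC : J ≤ C := by
    have := hx₀.2
    rw [hVJ] at this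
    exact (ENNReal.ofReal_le_ofReal_iff hC.le).1 this
  have hJβ : J ≤ P.beta C γ W * P.ellStar x₀ := by
    simpa only [hx0] using hP.tail_le_beta_mul_ellStar hA2 hC.le hux hopt hx₀.2 h0m
  have hIJ : I ≤ J := by
    have h1 := hP.integral_ell_add hux h0m hδm hTm
    have h2 := hP.integral_ell_nonneg (x := x) (u := u) hδT
    linarith
  have hlI : δ * P.ellStar x₀ ≤ Cbar * I := by
    have h1 := (hA3.2 δ ⟨hδ, hδT⟩ x₀ hx₀).trans
      (mul_le_mul_right (value_le_cost (hux.mono (Icc_subset_Icc_right hδT))) _)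
    rw [hcostI, ← ENNReal.ofReal_mul hCb.le] at h1
    exact (ENNReal.ofReal_le_ofReal_iff (by positivity)).1 h1
  have hα : Cbar * (P.beta C γ W / δ) ^ 2 * q < 1 :=
    (mul_le_mul_of_nonneg_right (le_max_right _ _) hq0.le).trans_lt hmax
  have hr : P.ratio C W / δ * q < 1 :=
    (mul_le_mul_of_nonneg_right (le_max_left _ _) hq0.le).trans_lt hmax
  set α := Cbar * (P.beta C γ W / δ) ^ 2 * q with hαdef
  rw [hcostI, hVJ, ← ENNReal.ofReal_mul (by linarith)]
  by_cases hN3 : 2 ≤ N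
  · have hNcast : ((N - 1 : ℕ) : ℝ) = N - 1 := by push_cast [hN1]; ring
    have hN2' : (2 : ℝ) ≤ N := by exact_mod_cast hN3
    set a := ((N - 1 : ℕ) : ℝ) * δ with ha
    have haδ : δ ≤ a := by rw [ha, hNcast]; nlinarith
    have haT : N * δ - a = δ := by rw [ha, hNcast]; ring
    have ham : a ∈ Icc 0 (N * δ) := ⟨by linarith, by linarith⟩
    have htail : ∫ s in a..(N * δ), P.ℓ (x s) (u s) ≤ q * J :=
      hP.tail_le_pow_mul hA2 hC.le hδ hux hopt hx₀.2 (Nat.sub_le N 1)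
    obtain ⟨t, ht, htle⟩ := exists_le_setAverage (μ := volume) (s := Icc a (N * δ))
      (f := fun s => P.ℓ (x s) (u s)) (by simp [Real.volume_Icc, haT, hδ]) (by simp)
      ((hP.integrableOn_ell hux.1 hux.2.1.1).mono_set (Icc_subset_Icc_left ham.1))
    rw [setAverage_eq, Real.volume_real_Icc_of_le ham.2, haT, integral_Icc_eq_integral_Ioc,
      ← intervalIntegral.integral_of_le ham.2, smul_eq_mul, inv_mul_eq_div,
      le_div_iff₀ hδ] at htle
    have htm : t ∈ Icc 0 (N * δ) := ⟨ham.1.trans ht.1, ht.2⟩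
    have htE := hux.2.2 t htm
    have htX : x t ∈ P.stateSet := ⟨u t, htE⟩
    have hlt : P.ellStar (x t) * δ ≤ q * J := by
      have := hP.ellStar_le htE
      calc P.ellStar (x t) * δ ≤ P.ℓ (x t) (u t) * δ := by gcongr
        _ ≤ _ := htle.trans htail
    have htW : x t ∈ W := by
      by_contra hW
      have h1 := hP.le_ratio_mul_ellStar (C := C) hA2.2.1 htX hW
      have hr0 : 0 ≤ P.ratio C W := ENNReal.toReal_nonneg
      have h2 : C * δ ≤ P.ratio C W * (q * C) := by
        calc C * δ ≤ P.ratio C W * P.ellStar (x t) * δ := by gcongr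
          _ = P.ratio C W * (P.ellStar (x t) * δ) := by ring
          _ ≤ P.ratio C W * (q * C) :=
            mul_le_mul_of_nonneg_left (hlt.trans (by gcongr)) hr0
      have h3 : P.ratio C W * q < δ := by
        rwa [div_mul_eq_mul_div, div_lt_one hδ] at hr
      nlinarith
    have hδt : δ ≤ t := haδ.trans ht.1
    have hmid : ∫ s in δ..t, P.ℓ (x s) (u s) ≤ J - I := by
      have h1 := hP.integral_ell_add hux h0m hδm htm
      have h2 := hP.integral_ell_add hux h0m htm hTm
      have h3 := hP.integral_ell_nonneg (x := x) (u := u) htm.2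
      linarith
    have hend : γ * P.ellStar (x t) ≤ α * I := by
      have h1 : P.ellStar (x t) ≤ q * J / δ := (le_div_iff₀ hδ).2 hlt
      have h2 : P.ellStar x₀ ≤ Cbar * I / δ := by
        rw [le_div_iff₀ hδ]; linarith
      have hl := hP.ellStar_nonneg htX
      calc γ * P.ellStar (x t) ≤ P.beta C γ W * (q * J / δ) := by gcongr
        _ ≤ P.beta C γ W * (q * (P.beta C γ W * (Cbar * I / δ)) / δ) := by
          gcongr
          exact hJβ.trans (by gcongr)
        _ = α * I := by rw [hαdef]; field_simp
    have hV : P.V (N * δ) (x δ) ≤ ENNReal.ofReal (J - (1 - α) * I) := by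
      calc P.V (N * δ) (x δ) ≤ P.VInf (x δ) := V_le_VInf _ _
        _ ≤ (∫⁻ s in Icc δ t, ENNReal.ofReal (P.ℓ (x s) (u s))) + P.VInf (x t) :=
          hP.VInf_le_lintegral_add hux hδ.le hδt ht.2
        _ ≤ ENNReal.ofReal (∫ s in δ..t, P.ℓ (x s) (u s)) +
            ENNReal.ofReal (γ * P.ellStar (x t)) := by
          rw [hP.lintegral_ell_eq hux hδ.le hδt ht.2]
          gcongr
          exact hA2.2.2 _ ⟨htW, htX⟩
        _ = ENNReal.ofReal ((∫ s in δ..t, P.ℓ (x s) (u s)) + γ * P.ellStar (x t)) :=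
          (ENNReal.ofReal_add (hP.integral_ell_nonneg hδt)
            (mul_nonneg hγ.le (hP.ellStar_nonneg htX))).symm
        _ ≤ _ := ENNReal.ofReal_le_ofReal (by linarith)
    have h1α : (1 - α) * I ≤ J := by
      have : 0 ≤ α := by positivity
      nlinarith
    calc _ ≤ ENNReal.ofReal (J - (1 - α) * I) + ENNReal.ofReal ((1 - α) * I) := by gcongr
      _ = ENNReal.ofReal J := by
        rw [← ENNReal.ofReal_add (by linarith) (mul_nonneg (by linarith) hI0), sub_add_cancel]
  -- For `N = 1` the horizon condition contradicts the growth bounds unless the state is the origin.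
  · have hN' : N = 1 := by omega
    subst hN'
    have hδβ : δ < P.beta C γ W := hN2.resolve_right (by norm_num)
    have hq1 : q = 1 := by simp [hq]
    have hl0 : P.ellStar x₀ ≤ 0 := by
      by_contra! hpos
      have h1 : δ * P.ellStar x₀ ≤ Cbar * (P.beta C γ W * P.ellStar x₀) :=
        hlI.trans (by gcongr; exact hIJ.trans hJβ)
      have h2 : δ ≤ Cbar * P.beta C γ W := by nlinarith
      rw [hαdef, hq1, mul_one, div_pow, ← mul_div_assoc, div_lt_one (by positivity)] at hα
      nlinarith
    have hJz : J = 0 := le_antisymm (hJβ.trans (mul_nonpos_of_nonneg_of_nonpos hβ.le hl0)) hJ0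
    have hIz : I = 0 := le_antisymm (hIJ.trans hJz.le) hI0
    have hxδ : x δ = 0 := by
      have h1 := hP.ofReal_mul_norm_sq_le_cost (by linarith : 0 < ((1 : ℕ) : ℝ) * δ) hux.1 hux.2.1
        hδm
      rw [hopt, hVJ, hJz, ENNReal.ofReal_zero, mul_zero, nonpos_iff_eq_zero,
        ENNReal.ofReal_eq_zero, Nat.cast_one, one_mul] at h1
      have h2 : ‖x δ‖ ^ 2 ≤ 0 := by nlinarith
      simpa using le_antisymm h2 (sq_nonneg _)
    rw [hxδ, hIz, hJz]
    simpa using (V_le_VInf (((1 : ℕ) : ℝ) * δ) (0 : EuclideanSpace ℝ (Fin n))).trans_eq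
      (hP.VInf_zero hA2)

end IsLinearQuadratic
end ControlProblem

/-! ### The closed loop -/

theorem IsControl.comp_add_right {m : ℕ} {u : ℝ → EuclideanSpace ℝ (Fin m)} (hu : IsControl u)
    {a : ℝ} (ha : 0 ≤ a) : IsControl fun s => u (s + a) := by
  refine ⟨(aemeasurable_comp_add_right hu.1 a).mono_measure (Measure.restrict_mono
    (Ici_subset_Ici.2 (by linarith)) le_rfl), fun T => ?_⟩
  obtain ⟨c, hc⟩ := hu.2 (T + a)
  refine ⟨c, ?_⟩
  have h := (measurePreserving_add_right (volume : Measure ℝ) a).restrict_preimage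
    (measurableSet_Icc (a := (0 : ℝ)) (b := T + a))
  have h2 := h.quasiMeasurePreserving.ae hc
  rw [preimage_add_const_Icc, add_sub_cancel_right] at h2
  exact ae_mono (Measure.restrict_mono (Icc_subset_Icc_left (by linarith)) le_rfl) h2

namespace ControlProblem

variable {n m : ℕ} {P : ControlProblem n m}

namespace IsLinearQuadratic

variable {A : EuclideanSpace ℝ (Fin n) →L[ℝ] EuclideanSpace ℝ (Fin n)}
  {B : EuclideanSpace ℝ (Fin m) →L[ℝ] EuclideanSpace ℝ (Fin n)} {c₁ c₂ : ℝ}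
  {u : ℝ → EuclideanSpace ℝ (Fin m)} {x : ℝ → EuclideanSpace ℝ (Fin n)}
  {x₀ : EuclideanSpace ℝ (Fin n)} {T δ : ℝ}
  {μ : EuclideanSpace ℝ (Fin n) → ℝ → EuclideanSpace ℝ (Fin m)}

theorem isSolution_comp_add_right (hP : P.IsLinearQuadratic A B c₁ c₂) (hu : IsControl u)
    (hx : P.IsSolution (Ici 0) x₀ u x) {a : ℝ} (ha : 0 ≤ a) :
    P.IsSolution (Icc 0 T) (x a) (fun s => u (s + a)) (fun s => x (s + a)) := by
  refine ⟨hx.1.comp (by fun_prop) fun s hs => mem_Ici.2 (by linarith [hs.1]), fun t ht => ?_⟩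
  have h := hP.sub_eq_integral (T := t + a) (a := a) (b := t + a) hu
    ⟨hx.1.mono Icc_subset_Ici_self, fun s hs => hx.2 s hs.1⟩
    ⟨ha, by linarith [ht.1]⟩ ⟨by linarith [ht.1], le_rfl⟩
  rw [intervalIntegral.integral_comp_add_right (fun s => P.f (x s) (u s)), zero_add, ← h]
  abel

/-- A control determines its trajectory: the difference of two solutions solves the homogeneous
linear equation. -/
theorem eqOn_of_isSolution (hP : P.IsLinearQuadratic A B c₁ c₂)
    {u₁ u₂ : ℝ → EuclideanSpace ℝ (Fin m)} {x₁ x₂ : ℝ → EuclideanSpace ℝ (Fin n)}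
    (hu₁ : IsControl u₁) (hu₂ : IsControl u₂) (hx₁ : P.IsSolution (Icc 0 T) x₀ u₁ x₁)
    (hx₂ : P.IsSolution (Icc 0 T) x₀ u₂ x₂) (hu : ∀ s ∈ Ico 0 T, u₁ s = u₂ s) :
    EqOn x₁ x₂ (Icc 0 T) := by
  rcases lt_or_ge T 0 with hT | hT
  · simp [Icc_eq_empty_of_lt hT]
  have h0 : (0 : ℝ) ∈ Icc 0 T := ⟨le_rfl, hT⟩
  -- a globally continuous extension of the difference
  set D : ℝ → EuclideanSpace ℝ (Fin n) := IccExtend hT fun s : Icc 0 T => x₁ s - x₂ s with hD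
  have hDc : Continuous D :=
    continuous_IccExtend_iff.2 (continuousOn_iff_continuous_domRestrict.1 (hx₁.1.sub hx₂.1))
  have hDeq : ∀ s ∈ Icc 0 T, D s = x₁ s - x₂ s := fun s hs => IccExtend_of_mem hT _ hs
  set Y : ℝ → EuclideanSpace ℝ (Fin n) := fun t => ∫ s in (0 : ℝ)..t, A (D s) with hY
  have hYd : ∀ t, HasDerivAt Y (A (D t)) t := fun t =>
    intervalIntegral.integral_hasDerivAt_right ((A.continuous.comp hDc).intervalIntegrable _ _)
      ((A.continuous.comp hDc).stronglyMeasurableAtFilter _ _) (A.continuous.comp hDc).continuousAt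
  have hYD : ∀ t ∈ Icc 0 T, Y t = D t := by
    intro t ht
    rw [hDeq t ht, hx₁.2 t ht, hx₂.2 t ht, add_sub_add_left_eq_sub,
      ← intervalIntegral.integral_sub (hP.intervalIntegrable_f hu₁ hx₁.1 h0 ht)
        (hP.intervalIntegrable_f hu₂ hx₂.1 h0 ht)]
    refine intervalIntegral.integral_congr_Ioo_of_le ht.1 fun s hs => ?_
    have hs' : s ∈ Ico 0 T := ⟨hs.1.le, hs.2.trans_le ht.2⟩
    simp only [hDeq s (Ico_subset_Icc_self hs'), hP.f_eq, hu s hs', map_sub]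
    abel
  have hYc : Continuous Y := continuous_iff_continuousAt.2 fun t => (hYd t).continuousAt
  have hz := eq_zero_of_abs_deriv_le_mul_abs_self_of_eq_zero_right (f := Y) (K := ‖A‖) (a := 0) (b := T)
    hYc.continuousOn (fun t _ => (hYd t).hasDerivWithinAt) (by simp [hY]) (fun t ht => by
      rw [hYD t (Ico_subset_Icc_self ht)]
      exact A.le_opNorm _)
  intro t ht
  rw [← sub_eq_zero, ← hDeq t ht, ← hYD t ht, hz t ht]

/-- The concatenation of the selected trajectories over the sampling periods is a closed-loop
trajectory, if every state in `S` has one that is admissible and returns to `S` at time `δ`. -/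
theorem exists_isClosedLoop (hP : P.IsLinearQuadratic A B c₁ c₂) (hδ : 0 < δ) (hδT : δ ≤ T)
    {S : Set (EuclideanSpace ℝ (Fin n))}
    (hS : ∀ y ∈ S, ∃ X, P.IsAdmissiblePair (Icc 0 T) y (μ y) X ∧ X δ ∈ S) (hx₀ : x₀ ∈ S) :
    ∃ u x, P.IsClosedLoop δ μ x₀ u x := by
  obtain ⟨R, hR, hRE⟩ := hP.exists_norm_le
  have hS' : ∀ y, ∃ X, y ∈ S → P.IsAdmissiblePair (Icc 0 T) y (μ y) X ∧ X δ ∈ S := by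
    intro y
    by_cases hy : y ∈ S
    · obtain ⟨X, hX⟩ := hS y hy
      exact ⟨X, fun _ => hX⟩
    · exact ⟨fun _ => 0, fun h => absurd h hy⟩
  choose X hX using hS'
  let y : ℕ → EuclideanSpace ℝ (Fin n) := fun k => Nat.rec x₀ (fun _ z => X z δ) k
  have hy0 : y 0 = x₀ := rfl
  have hysucc : ∀ k, y (k + 1) = X (y k) δ := fun k => rfl
  have hyS : ∀ k, y k ∈ S := by
    intro k
    induction k with
    | zero => exact hx₀
    | succ k ih => exact (hX _ ih).2
  have hpair : ∀ k, P.IsAdmissiblePair (Icc 0 T) (y k) (μ (y k)) (X (y k)) := fun k =>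
    (hX _ (hyS k)).1
  have hX0 : ∀ k, X (y k) 0 = y k := fun k => by
    simpa using (hpair k).2.1.2 0 ⟨le_rfl, hδ.le.trans hδT⟩
  set κ : ℝ → ℕ := fun t => ⌊t / δ⌋₊ with hκ
  have hκeq : ∀ (k : ℕ) (t : ℝ), t ∈ Ico (k * δ) ((k + 1) * δ) → κ t = k := by
    intro k t ht
    have h0 : 0 ≤ t := le_trans (by positivity) ht.1
    refine (Nat.floor_eq_iff (by positivity)).2 ⟨(le_div_iff₀ hδ).2 ht.1, (div_lt_iff₀ hδ).2 ht.2⟩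
  have hκmem : ∀ t, 0 ≤ t → t ∈ Ico (κ t * δ) ((κ t + 1) * δ) := fun t ht =>
    ⟨(le_div_iff₀ hδ).1 (Nat.floor_le (by positivity)),
      (div_lt_iff₀ hδ).1 (Nat.lt_floor_add_one _)⟩
  set u : ℝ → EuclideanSpace ℝ (Fin m) := fun t => μ (y (κ t)) (t + -(κ t * δ)) with hu
  set x : ℝ → EuclideanSpace ℝ (Fin n) := fun t => X (y (κ t)) (t + -(κ t * δ)) with hx
  have hxE : ∀ t, 0 ≤ t → (x t, u t) ∈ P.E := by
    intro t ht
    have h := hκmem t ht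
    exact (hpair (κ t)).2.2 _ ⟨by linarith [h.1], by nlinarith [h.2]⟩
  have huc : IsControl u := by
    refine IsControl.of_norm_le (c := R) ?_ fun t ht =>
      (norm_snd_le (x t, u t)).trans (hRE _ (hxE t ht))
    have hcover : Ici (0 : ℝ) ⊆ ⋃ k : ℕ, Ico (k * δ) ((k + 1) * δ) := fun t ht =>
      mem_iUnion.2 ⟨κ t, hκmem t ht⟩
    refine AEMeasurable.mono_measure ?_ (Measure.restrict_mono hcover le_rfl)
    refine aemeasurable_iUnion_iff.2 fun k => ?_
    have h := aemeasurable_comp_add_right (hpair k).1.1 (-(k * δ))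
    rw [neg_neg] at h
    refine (h.mono_measure (Measure.restrict_mono (fun s hs => hs.1) le_rfl)).congr ?_
    filter_upwards [ae_restrict_mem measurableSet_Ico] with s hs
    simp only [hu, hκeq k s hs]
  have hpiece : ∀ (k : ℕ) (t : ℝ), t ∈ Icc (k * δ) ((k + 1) * δ) →
      IntervalIntegrable (fun s => P.f (x s) (u s)) volume (k * δ) t ∧
        y k + ∫ s in (k * δ)..t, P.f (x s) (u s) = X (y k) (t + -(k * δ)) := by
    intro k t ht
    have h0 : t + -(k * δ) ∈ Icc 0 T := ⟨by linarith [ht.1], by nlinarith [ht.2]⟩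
    have hz : (k * δ : ℝ) + -(k * δ) ∈ Icc 0 T := by
      rw [add_neg_cancel]; exact ⟨le_rfl, hδ.le.trans hδT⟩
    have h := intervalIntegral_of_eq_shift (F := fun s => P.f (x s) (u s))
      (G := fun s => P.f (X (y k) s) (μ (y k) s)) (a := -(k * δ)) ht.1 (fun s hs => by
        simp only [hx, hu, hκeq k s ⟨hs.1, hs.2.trans_le ht.2⟩])
      (hP.intervalIntegrable_f (hpair k).1 (hpair k).2.1.1 hz h0)
    refine ⟨h.1, ?_⟩
    rw [h.2, add_neg_cancel]
    exact ((hpair k).2.1.2 _ h0).symm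
  have hgrid : ∀ k : ℕ, IntervalIntegrable (fun s => P.f (x s) (u s)) volume 0 (k * δ) ∧
      y k = x₀ + ∫ s in (0 : ℝ)..(k * δ), P.f (x s) (u s) := by
    intro k
    induction k with
    | zero => simp [hy0]
    | succ k ih =>
      have h := hpiece k ((k + 1) * δ) ⟨by nlinarith, le_rfl⟩
      have h1 : (k + 1) * δ + -(k * δ) = δ := by ring
      rw [h1, ← hysucc] at h
      push_cast
      refine ⟨ih.1.trans h.1, ?_⟩
      rw [← h.2, ih.2, add_assoc, intervalIntegral.integral_add_adjacent_intervals ih.1 h.1]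
  refine ⟨u, x, huc, isSolution_Ici (fun t ht => ?_) (fun t ht => ?_), fun k t ht => ?_⟩
  · exact (hgrid (κ t)).1.trans (hpiece (κ t) t (Ico_subset_Icc_self (hκmem t ht))).1
  · have h := hpiece (κ t) t (Ico_subset_Icc_self (hκmem t ht))
    rw [← intervalIntegral.integral_add_adjacent_intervals (hgrid (κ t)).1 h.1, ← add_assoc,
      ← (hgrid (κ t)).2, h.2]
  · have hk : κ (k * δ) = k := hκeq k _ ⟨le_rfl, by nlinarith⟩
    have hxk : x (k * δ) = y k := by simp only [hx, hk, add_neg_cancel, hX0]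
    rw [hxk]
    simp only [hu, hκeq k t ht, sub_eq_add_neg]

/-- Over one sampling period, a closed-loop trajectory follows the trajectory that the feedback
selects at the start of the period. -/
theorem isClosedLoop_eq (hP : P.IsLinearQuadratic A B c₁ c₂) (hδ : 0 < δ) (hδT : δ ≤ T)
    (hcl : P.IsClosedLoop δ μ x₀ u x) (k : ℕ) {X : ℝ → EuclideanSpace ℝ (Fin n)}
    (hX : P.IsAdmissiblePair (Icc 0 T) (x (k * δ)) (μ (x (k * δ))) X) :
    ∀ s ∈ Icc 0 δ, x (s + k * δ) = X s := by
  have hk : (0 : ℝ) ≤ k * δ := by positivity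
  exact hP.eqOn_of_isSolution (hcl.1.comp_add_right hk) hX.1
    (hP.isSolution_comp_add_right hcl.1 hcl.2.1 hk) (hX.mono (Icc_subset_Icc_right hδT)).2.1
    fun s hs => by
      rw [hcl.2.2 k (s + k * δ) ⟨by linarith [hs.1], by linarith [hs.2]⟩, add_sub_cancel_right]

/-- Stability of the closed loop from a relaxed Lyapunov inequality on an invariant set `S`: the total
cost is finite, so the costs over the sampling periods tend to zero, and these control the states in
between. -/
theorem closedLoop_stability (hP : P.IsLinearQuadratic A B c₁ c₂) (hδ : 0 < δ) (hδT : δ ≤ T)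
    {S : Set (EuclideanSpace ℝ (Fin n))} {Λ : EuclideanSpace ℝ (Fin n) → ℝ≥0∞}
    (hΛ : ∀ y ∈ S, Λ y ≠ ⊤) {η : ℝ} (hη : 0 < η)
    (hS : ∀ y ∈ S, ∃ X, P.IsAdmissiblePair (Icc 0 T) y (μ y) X ∧ X δ ∈ S ∧
      Λ (X δ) + ENNReal.ofReal η * P.cost (Icc 0 δ) (μ y) X ≤ Λ y)
    (hx₀ : x₀ ∈ S) (hcl : P.IsClosedLoop δ μ x₀ u x) :
    (∀ k : ℕ, (P.admissible (Icc 0 T) (x (k * δ))).Nonempty) ∧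
      (∀ t ∈ Ici (0 : ℝ), (x t, u t) ∈ P.E) ∧ Tendsto x atTop (𝓝 0) ∧
      ∀ t ∈ Ici (0 : ℝ), ENNReal.ofReal (η * (δ * ‖x t‖ ^ 2)) ≤
        ENNReal.ofReal ((2 + 2 * (‖A.coprod B‖ * δ) ^ 2) / c₁) * Λ x₀ := by
  have hx0 : x 0 = x₀ := by simpa using hcl.2.1.2 0 self_mem_Ici
  have hmemS : ∀ k : ℕ, x (k * δ) ∈ S := by
    intro k
    induction k with
    | zero => simpa [hx0] using hx₀
    | succ k ih =>
      obtain ⟨X, hX, hXS, -⟩ := hS _ ih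
      have h := hP.isClosedLoop_eq hδ hδT hcl k hX δ ⟨hδ.le, le_rfl⟩
      have h1 : ((k + 1 : ℕ) : ℝ) * δ = δ + k * δ := by push_cast; ring
      rwa [h1, h]
  choose X hX hXS hXΛ using fun k : ℕ => hS _ (hmemS k)
  have hxX := fun k => hP.isClosedLoop_eq hδ hδT hcl k (hX k)
  set I : ℕ → ℝ≥0∞ := fun k => P.cost (Icc 0 δ) (μ (x (k * δ))) (X k) with hI
  have hdec : ∀ k : ℕ, Λ (x ((k + 1 : ℕ) * δ)) + ENNReal.ofReal η * I k ≤ Λ (x (k * δ)) := by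
    intro k
    have h1 : ((k + 1 : ℕ) : ℝ) * δ = δ + k * δ := by push_cast; ring
    rw [h1, hxX k δ ⟨hδ.le, le_rfl⟩]
    exact hXΛ k
  have hsum : ∀ k : ℕ, Λ (x (k * δ)) + ENNReal.ofReal η * ∑ j ∈ Finset.range k, I j ≤ Λ x₀ := by
    intro k
    induction k with
    | zero => simp [hx0]
    | succ k ih =>
      rw [Finset.sum_range_succ, mul_add, add_comm (ENNReal.ofReal η * _), ← add_assoc]
      exact (add_le_add_left (hdec k) _).trans ih
  have hη0 : ENNReal.ofReal η ≠ 0 := (ENNReal.ofReal_pos.2 hη).ne'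
  have htsum : ENNReal.ofReal η * ∑' j, I j ≤ Λ x₀ := by
    rw [ENNReal.tsum_eq_iSup_nat, ENNReal.mul_iSup]
    exact iSup_le fun k => le_add_self.trans (hsum k)
  have hI0 : Tendsto I atTop (𝓝 0) := by
    refine ENNReal.tendsto_atTop_zero_of_tsum_ne_top fun h => ?_
    rw [h, ENNReal.mul_top hη0, top_le_iff] at htsum
    exact hΛ _ hx₀ htsum
  set κ : ℝ → ℕ := fun t => ⌊t / δ⌋₊ with hκ
  have hκmem : ∀ t, 0 ≤ t → t ∈ Ico (κ t * δ) ((κ t + 1) * δ) := fun t ht =>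
    ⟨(le_div_iff₀ hδ).1 (Nat.floor_le (by positivity)),
      (div_lt_iff₀ hδ).1 (Nat.lt_floor_add_one _)⟩
  have hs : ∀ t, 0 ≤ t → t - κ t * δ ∈ Ico 0 δ := fun t ht => by
    have := hκmem t ht
    exact ⟨by linarith [this.1], by linarith [this.2]⟩
  have hxt : ∀ t, 0 ≤ t → x t = X (κ t) (t - κ t * δ) := fun t ht => by
    rw [← hxX (κ t) _ (Ico_subset_Icc_self (hs t ht)), sub_add_cancel]
  set c := ENNReal.ofReal ((2 + 2 * (‖A.coprod B‖ * δ) ^ 2) / c₁) with hc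
  have hbound : ∀ t, 0 ≤ t → ENNReal.ofReal (δ * ‖x t‖ ^ 2) ≤ c * I (κ t) := by
    intro t ht
    rw [hxt t ht]
    exact hP.ofReal_mul_norm_sq_le_cost hδ (hX (κ t)).1
      ((hX (κ t)).mono (Icc_subset_Icc_right hδT)).2.1 (Ico_subset_Icc_self (hs t ht))
  refine ⟨fun k => ⟨_, _, hX k⟩, fun t ht => ?_, ?_, fun t ht => ?_⟩
  · have h := hs t ht
    rw [hcl.2.2 (κ t) t (hκmem t ht), hxt t ht]
    exact (hX (κ t)).2.2 _ ⟨h.1, h.2.le.trans hδT⟩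
  · have hκt : Tendsto κ atTop atTop :=
      tendsto_nat_floor_atTop.comp (tendsto_id.atTop_div_const hδ)
    have h1 : Tendsto (fun t => c * I (κ t)) atTop (𝓝 0) := by
      have := ENNReal.Tendsto.const_mul (a := c) (hI0.comp hκt) (Or.inr ENNReal.ofReal_ne_top)
      simpa using this
    have h2 : Tendsto (fun t => ENNReal.ofReal (δ * ‖x t‖ ^ 2)) atTop (𝓝 0) :=
      tendsto_of_tendsto_of_tendsto_of_le_of_le' tendsto_const_nhds h1
        (Eventually.of_forall fun _ => zero_le)
        ((eventually_ge_atTop 0).mono fun t ht => hbound t ht)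
    have h3 := (ENNReal.tendsto_toReal ENNReal.zero_ne_top).comp h2
    have h4 : Tendsto (fun t => ‖x t‖ ^ 2) atTop (𝓝 0) := by
      have h5 := h3.const_mul δ⁻¹
      rw [ENNReal.toReal_zero, mul_zero] at h5
      refine h5.congr fun t => ?_
      rw [Function.comp_apply, ENNReal.toReal_ofReal (by positivity), inv_mul_cancel_left₀ hδ.ne']
    rw [tendsto_zero_iff_norm_tendsto_zero]
    have h6 := (Real.continuous_sqrt.tendsto 0).comp h4
    rw [Real.sqrt_zero] at h6
    exact h6.congr fun t => by simp
  · calc ENNReal.ofReal (η * (δ * ‖x t‖ ^ 2))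
        = ENNReal.ofReal η * ENNReal.ofReal (δ * ‖x t‖ ^ 2) := ENNReal.ofReal_mul hη.le
      _ ≤ ENNReal.ofReal η * (c * I (κ t)) := by gcongr; exact hbound t ht
      _ = c * (ENNReal.ofReal η * I (κ t)) := by ring
      _ ≤ c * Λ x₀ := by
        gcongr
        exact (mul_le_mul_right (ENNReal.le_tsum (κ t)) _).trans htsum

end IsLinearQuadratic
end ControlProblem

/-! ### Asymptotic stability under the horizon condition -/

namespace ControlProblem

variable {n m : ℕ} {P : ControlProblem n m}

theorem nonempty_admissible_of_V_ne_top {T : ℝ} {x₀ : EuclideanSpace ℝ (Fin n)}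
    (h : P.V T x₀ ≠ ⊤) : (P.admissible (Icc 0 T) x₀).Nonempty := by
  by_contra hne
  refine h ?_
  simp only [V, value, iInf_eq_top]
  intro u x hux
  exact absurd ⟨u, x, hux⟩ hne

namespace IsLinearQuadratic

variable {A : EuclideanSpace ℝ (Fin n) →L[ℝ] EuclideanSpace ℝ (Fin n)}
  {B : EuclideanSpace ℝ (Fin m) →L[ℝ] EuclideanSpace ℝ (Fin n)} {c₁ c₂ : ℝ}
  {C γ Cbar δ : ℝ} {W : Set (EuclideanSpace ℝ (Fin n))} {N : ℕ}
  {μ : EuclideanSpace ℝ (Fin n) → ℝ → EuclideanSpace ℝ (Fin m)}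

/-- Near the origin the infinite-horizon value function is at most quadratic. -/
theorem exists_eventually_VInf_le (hP : P.IsLinearQuadratic A B c₁ c₂) (hA2 : P.A2 γ W) :
    ∃ a > 0, ∀ᶠ x in 𝓝 (0 : EuclideanSpace ℝ (Fin n)),
      x ∈ P.stateSet ∧ P.VInf x ≤ ENNReal.ofReal (a * ‖x‖ ^ 2) := by
  obtain ⟨c, hc, hcX⟩ := hP.exists_ellStar_le_mul_sq
  obtain ⟨r, hr, hrE⟩ := hP.exists_ball_subset
  have hγ := hA2.1
  refine ⟨γ * c, by positivity, ?_⟩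
  filter_upwards [hA2.2.1, Metric.ball_mem_nhds 0 hr] with x hxW hxr
  have hX : x ∈ P.stateSet := ⟨0, hrE (x, 0) (by
    rw [mem_ball_zero_iff] at hxr
    simpa [Prod.norm_def] using hxr.le)⟩
  refine ⟨hX, (hA2.2.2 x ⟨hxW, hX⟩).trans (ENNReal.ofReal_le_ofReal ?_)⟩
  rw [mul_assoc]
  gcongr
  exact hcX x hX

theorem sublevel_mem_nhds (hP : P.IsLinearQuadratic A B c₁ c₂) (hA2 : P.A2 γ W) (hC : 0 < C)
    (T : ℝ) : P.sublevel T C ∈ 𝓝 0 := by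
  obtain ⟨a, ha, h⟩ := hP.exists_eventually_VInf_le hA2
  have h1 : ∀ᶠ x in 𝓝 (0 : EuclideanSpace ℝ (Fin n)), a * ‖x‖ ^ 2 < C := by
    have hc : Continuous fun x : EuclideanSpace ℝ (Fin n) => a * ‖x‖ ^ 2 := by fun_prop
    exact (hc.tendsto 0).eventually_lt_const (by simpa using hC)
  filter_upwards [h, h1] with x hx hx1
  exact ⟨hx.1, (V_le_VInf T x).trans (hx.2.trans (ENNReal.ofReal_le_ofReal hx1.le))⟩

/-- Under the horizon condition, the sublevel set of the value function belongs to the basin of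
attraction, and the origin is asymptotically stable. -/
theorem isAsymptoticallyStable_of_horizonCondition (hP : P.IsLinearQuadratic A B c₁ c₂)
    (hδ : 0 < δ) (hC : 0 < C) (hA2 : P.A2 γ W) (hA3 : P.A3 (N * δ) C Cbar)
    (hH : P.HorizonCondition C γ W Cbar δ N) (hμ : P.IsMPCFeedback (N * δ) μ) :
    P.IsAsymptoticallyStable (N * δ) δ μ ∧
      P.sublevel (N * δ) C ⊆ P.basin (N * δ) δ μ := by
  have hN : (1 : ℝ) ≤ N := by exact_mod_cast hH.1
  have hδT : δ ≤ N * δ := by nlinarith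
  set η := 1 - Cbar * (P.beta C γ W / δ) ^ 2 *
    (P.beta C γ W / (P.beta C γ W + δ)) ^ (N - 1) with hηdef
  have hη : 0 < η := by
    have hβ := beta_pos (C := C) hA2
    have h := (mul_le_mul_of_nonneg_right (le_max_right (P.ratio C W / δ) _)
      (by positivity)).trans_lt hH.2.2
    linarith
  have hfin : ∀ y ∈ P.sublevel (N * δ) C, P.V (N * δ) y ≠ ⊤ := fun y hy =>
    (hy.2.trans_lt ENNReal.ofReal_lt_top).ne
  have hstep : ∀ y ∈ P.sublevel (N * δ) C, ∃ X, P.IsAdmissiblePair (Icc 0 (N * δ)) y (μ y) X ∧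
      X δ ∈ P.sublevel (N * δ) C ∧
      P.V (N * δ) (X δ) + ENNReal.ofReal η * P.cost (Icc 0 δ) (μ y) X ≤ P.V (N * δ) y := by
    intro y hy
    obtain ⟨X, hX, hopt⟩ := hμ y (nonempty_admissible_of_V_ne_top (hfin y hy))
    have h := hP.V_add_le_V hA2 hA3 hH hC hδ hy hX hopt
    exact ⟨X, hX, ⟨⟨μ y δ, hX.2.2 δ ⟨hδ.le, hδT⟩⟩, (le_self_add.trans h).trans hy.2⟩, h⟩
  have hbasin : P.sublevel (N * δ) C ⊆ P.basin (N * δ) δ μ := by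
    intro x₀ hx₀
    refine ⟨hP.exists_isClosedLoop hδ hδT (fun y hy => ?_) hx₀, fun u x hcl => ?_⟩
    · obtain ⟨X, hX, hXS, -⟩ := hstep y hy
      exact ⟨X, hX, hXS⟩
    · obtain ⟨h1, h2, h3, -⟩ := hP.closedLoop_stability hδ hδT hfin hη hstep hx₀ hcl
      exact ⟨h1, h2, h3⟩
  have hnhds := hP.sublevel_mem_nhds hA2 hC (N * δ)
  refine ⟨⟨fun ε hε => ?_, Filter.mem_of_superset hnhds hbasin⟩, hbasin⟩
  obtain ⟨a, ha, hV⟩ := hP.exists_eventually_VInf_le hA2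
  have hc₁ := hP.c₁_pos
  set c := (2 + 2 * (‖A.coprod B‖ * δ) ^ 2) / c₁ with hc
  have hsmall : ∀ᶠ x in 𝓝 (0 : EuclideanSpace ℝ (Fin n)),
      c * (a * ‖x‖ ^ 2) < η * (δ * ε ^ 2) := by
    have hcont : Continuous fun x : EuclideanSpace ℝ (Fin n) => c * (a * ‖x‖ ^ 2) := by fun_prop
    refine (hcont.tendsto 0).eventually_lt_const ?_
    have : 0 < η * (δ * ε ^ 2) := by positivity
    simpa using this
  obtain ⟨ρ, hρ, hball⟩ := Metric.eventually_nhds_iff.1 ((hV.and hsmall).and hnhds)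
  refine ⟨ρ, hρ, fun x₀ hx₀ u x hcl t ht => ?_⟩
  obtain ⟨⟨⟨-, hVx⟩, hsx⟩, hSx⟩ := hball (y := x₀) (by simpa using hx₀)
  obtain ⟨-, -, -, h⟩ := hP.closedLoop_stability hδ hδT hfin hη hstep hSx hcl
  have h1 : ENNReal.ofReal (η * (δ * ‖x t‖ ^ 2)) ≤ ENNReal.ofReal (c * (a * ‖x₀‖ ^ 2)) := by
    calc _ ≤ ENNReal.ofReal c * P.V (N * δ) x₀ := h t ht
      _ ≤ ENNReal.ofReal c * ENNReal.ofReal (a * ‖x₀‖ ^ 2) := by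
        gcongr
        exact (V_le_VInf _ _).trans hVx
      _ = _ := (ENNReal.ofReal_mul (by positivity)).symm
  have h2 := ((ENNReal.ofReal_le_ofReal_iff (by positivity)).1 h1).trans_lt hsx
  have h3 : ‖x t‖ ^ 2 < ε ^ 2 := by
    rwa [mul_lt_mul_iff_right₀ hη, mul_lt_mul_iff_right₀ hδ] at h2
  exact lt_of_pow_lt_pow_left₀ 2 hε.le h3

/-- The constant of `A3` grows only quadratically with the horizon, and is dominated by the geometric
factor of the horizon condition. -/
theorem exists_forall_horizonCondition (hP : P.IsLinearQuadratic A B c₁ c₂) (hδ : 0 < δ)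
    (hA2 : P.A2 γ W) : ∃ N₀ : ℕ, ∀ N ≥ N₀, ∃ Cbar, P.A3 (N * δ) C Cbar ∧
      P.HorizonCondition C γ W Cbar δ N := by
  obtain ⟨a, ha, b, hb, hA3⟩ := hP.exists_a3
  have hβ : 0 < P.beta C γ W := beta_pos hA2
  set β := P.beta C γ W with hβdef
  set q := β / (β + δ) with hq
  have hq0 : 0 < q := by positivity
  have hq1 : q < 1 := by rw [hq, div_lt_one (by positivity)]; linarith
  have hr0 : 0 ≤ P.ratio C W := ENNReal.toReal_nonneg
  have hlim : Tendsto (fun N : ℕ => (P.ratio C W / δ + a * (β / δ) ^ 2) / q * q ^ N +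
      b * δ ^ 2 * (β / δ) ^ 2 / q * ((N : ℝ) ^ 2 * q ^ N)) atTop (𝓝 0) := by
    have h1 := (tendsto_pow_atTop_nhds_zero_of_lt_one hq0.le hq1).const_mul
      ((P.ratio C W / δ + a * (β / δ) ^ 2) / q)
    have h2 := (tendsto_pow_const_mul_const_pow_of_lt_one 2 hq0.le hq1).const_mul
      (b * δ ^ 2 * (β / δ) ^ 2 / q)
    simpa using h1.add h2
  obtain ⟨N₀, hN₀⟩ := eventually_atTop.1 (hlim.eventually_lt_const zero_lt_one)
  refine ⟨max N₀ 2, fun N hN => ⟨a + b * (N * δ) ^ 2, hA3 _ _, ?_⟩⟩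
  have hN2 : 2 ≤ N := (le_max_right _ _).trans hN
  refine ⟨by omega, Or.inr hN2, ?_⟩
  have hpow : q ^ (N - 1) = q ^ N / q := by
    rw [eq_div_iff hq0.ne', ← pow_succ, Nat.sub_add_cancel (by omega)]
  refine lt_of_le_of_lt ?_ (hN₀ N ((le_max_left _ _).trans hN))
  rw [← hβdef, ← hq, hpow]
  calc max (P.ratio C W / δ) ((a + b * (N * δ) ^ 2) * (β / δ) ^ 2) * (q ^ N / q)
      ≤ (P.ratio C W / δ + (a + b * (N * δ) ^ 2) * (β / δ) ^ 2) * (q ^ N / q) := by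
        gcongr
        exact max_le_add_of_nonneg (by positivity) (by positivity)
    _ = _ := by ring

end IsLinearQuadratic

/-- A continuous function, homogeneous of degree two and positive away from the origin, is enclosed
by multiples of the squared norm, by compactness of the unit sphere. -/
theorem _root_.exists_mul_sq_le_of_homogeneous {E : Type*} [NormedAddCommGroup E] [NormedSpace ℝ E]
    [ProperSpace E] {Q : E → ℝ} (hQ : Continuous Q) (hhom : ∀ (c : ℝ) z, Q (c • z) = c ^ 2 * Q z)
    (hpos : ∀ z, z ≠ 0 → 0 < Q z) :
    ∃ c₁ > 0, ∃ c₂ > 0, ∀ z, c₁ * ‖z‖ ^ 2 ≤ Q z ∧ Q z ≤ c₂ * ‖z‖ ^ 2 := by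
  have hQ0 : Q 0 = 0 := by simpa using hhom 0 0
  have hcomp := isCompact_sphere (0 : E) 1
  have hunit : ∀ z : E, z ≠ 0 → ‖z‖⁻¹ • z ∈ Metric.sphere (0 : E) 1 := fun z hz => by
    rw [mem_sphere_zero_iff_norm, norm_smul, norm_inv, norm_norm,
      inv_mul_cancel₀ (norm_ne_zero_iff.2 hz)]
  have hscale : ∀ z : E, z ≠ 0 → Q z = Q (‖z‖⁻¹ • z) * ‖z‖ ^ 2 := fun z hz => by
    have := norm_ne_zero_iff.2 hz
    rw [hhom]
    field_simp
  rcases (Metric.sphere (0 : E) 1).eq_empty_or_nonempty with he | hne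
  · have hz : ∀ z : E, z = 0 := fun z => by
      by_contra hz
      exact (he ▸ hunit z hz : ‖z‖⁻¹ • z ∈ (∅ : Set E))
    exact ⟨1, one_pos, 1, one_pos, fun z => by simp [hz z, hQ0]⟩
  · obtain ⟨z₁, hz₁, hmin⟩ := hcomp.exists_isMinOn hne hQ.continuousOn
    obtain ⟨z₂, hz₂, hmax⟩ := hcomp.exists_isMaxOn hne hQ.continuousOn
    have hne0 : ∀ z ∈ Metric.sphere (0 : E) 1, z ≠ 0 := fun z hz =>
      ne_zero_of_mem_unit_sphere ⟨z, hz⟩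
    refine ⟨Q z₁, hpos _ (hne0 _ hz₁), Q z₂, hpos _ (hne0 _ hz₂), fun z => ?_⟩
    by_cases hz : z = 0
    · simp [hz, hQ0]
    · rw [hscale z hz]
      exact ⟨mul_le_mul_of_nonneg_right (hmin (hunit z hz)) (sq_nonneg _),
        mul_le_mul_of_nonneg_right (hmax (hunit z hz)) (sq_nonneg _)⟩

end ControlProblem

open ControlProblem

theorem isLinearQuadratic_lqProblem {n m p : ℕ}
    (A : Matrix (Fin n) (Fin n) ℝ) (B : Matrix (Fin n) (Fin m) ℝ)
    (U : Set (EuclideanSpace ℝ (Fin m)))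
    (g : Fin p → EuclideanSpace ℝ (Fin n) × EuclideanSpace ℝ (Fin m) → ℝ)
    (Q : Matrix (Fin n) (Fin n) ℝ) (S : Matrix (Fin n) (Fin m) ℝ) (R : Matrix (Fin m) (Fin m) ℝ)
    (hU_convex : Convex ℝ U) (hU_compact : IsCompact U) (hU_zero : 0 ∈ interior U)
    (hE_convex : Convex ℝ (mixedConstraintSet g)) (hE_compact : IsCompact (mixedConstraintSet g))
    (hE_zero : 0 ∈ interior (mixedConstraintSet g))
    (hcost : (Matrix.fromBlocks Q S S.transpose R).PosDef) :
    ∃ c₁ c₂, (lqProblem A B U g Q S R).IsLinearQuadratic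
      (Matrix.toEuclideanLin A).toContinuousLinearMap
      (Matrix.toEuclideanLin B).toContinuousLinearMap c₁ c₂ := by
  have hE : (lqProblem A B U g Q S R).E = mixedConstraintSet g ∩ Prod.snd ⁻¹' U := rfl
  have hcont : Continuous fun z : EuclideanSpace ℝ (Fin n) × EuclideanSpace ℝ (Fin m) =>
      (lqProblem A B U g Q S R).ℓ z.1 z.2 := by
    have hs : Continuous fun z : EuclideanSpace ℝ (Fin n) × EuclideanSpace ℝ (Fin m) =>
        (Sum.elim z.1.ofLp z.2.ofLp : Fin n ⊕ Fin m → ℝ) := by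
      refine continuous_pi fun i => ?_
      cases i <;> simp only [Sum.elim_inl, Sum.elim_inr] <;> fun_prop
    exact hs.dotProduct (continuous_const.matrix_mulVec hs)
  obtain ⟨c₁, hc₁, c₂, hc₂, h⟩ := exists_mul_sq_le_of_homogeneous hcont
    (fun c z => by
      have hs : (Sum.elim (c • z).1.ofLp (c • z).2.ofLp : Fin n ⊕ Fin m → ℝ) =
          c • Sum.elim z.1.ofLp z.2.ofLp := by
        ext i; cases i <;> simp
      simp only [lqProblem]
      rw [hs, Matrix.mulVec_smul, smul_dotProduct, dotProduct_smul, smul_eq_mul, smul_eq_mul]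
      ring)
    (fun z hz => by
      have hs : (Sum.elim z.1.ofLp z.2.ofLp : Fin n ⊕ Fin m → ℝ) ≠ 0 := by
        intro h0
        refine hz (Prod.ext ?_ ?_)
        · ext i; simpa using congrFun h0 (Sum.inl i)
        · ext i; simpa using congrFun h0 (Sum.inr i)
      exact hcost.dotProduct_mulVec_pos hs)
  refine ⟨c₁, c₂, fun x u => rfl, hcont, hc₁, hc₂, fun x u => (h (x, u)).1,
    fun x u => (h (x, u)).2, ?_, ?_, ?_⟩
  · rw [hE]
    exact hE_convex.inter (hU_convex.linear_preimage (LinearMap.snd ℝ _ _))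
  · rw [hE]
    exact hE_compact.inter_right (hU_compact.isClosed.preimage continuous_snd)
  · rw [hE, interior_inter]
    exact ⟨hE_zero, preimage_interior_subset_interior_preimage continuous_snd hU_zero⟩

theorem theorem2 {n m p : ℕ}
    (A : Matrix (Fin n) (Fin n) ℝ) (B : Matrix (Fin n) (Fin m) ℝ)
    (U : Set (EuclideanSpace ℝ (Fin m)))
    (g : Fin p → EuclideanSpace ℝ (Fin n) × EuclideanSpace ℝ (Fin m) → ℝ)
    (Q : Matrix (Fin n) (Fin n) ℝ) (S : Matrix (Fin n) (Fin m) ℝ) (R : Matrix (Fin m) (Fin m) ℝ)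
    (hAB : IsStabilisable A B)
    (hU_convex : Convex ℝ U) (hU_compact : IsCompact U) (hU_zero : 0 ∈ interior U)
    (hg : ∀ i, ContDiff ℝ 2 (g i))
    (hg_convex : ∀ i x, ConvexOn ℝ univ (fun u => g i (x, u)))
    (hE_convex : Convex ℝ (mixedConstraintSet g)) (hE_compact : IsCompact (mixedConstraintSet g))
    (hE_zero : 0 ∈ interior (mixedConstraintSet g))
    (hcost : (Matrix.fromBlocks Q S S.transpose R).PosDef)
    (K : Set (EuclideanSpace ℝ (Fin n))) (hK : IsCompact K)
    (hKA : K ⊆ interior (lqProblem A B U g Q S R).viabilityKernel)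
    (δ : ℝ) (hδ : 0 < δ) :
    -- the three assumptions behind the horizon condition hold
    (lqProblem A B U g Q S R).A1 ∧
    (∃ γ W, (lqProblem A B U g Q S R).A2 γ W) ∧
    (∀ T > 0, ∀ C > 0, ∃ Cbar, (lqProblem A B U g Q S R).A3 T C Cbar) ∧
    -- `V_∞` is bounded on `K`
    (∃ C > 0, ∀ x ∈ K, (lqProblem A B U g Q S R).VInf x ≤ ENNReal.ofReal C) ∧
    -- the horizon condition holds for all sufficiently large `N`
    (∀ C γ W, 0 < C → (lqProblem A B U g Q S R).A2 γ W →
      ∃ N₀ : ℕ, ∀ N ≥ N₀, ∃ Cbar, (lqProblem A B U g Q S R).A3 (N * δ) C Cbar ∧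
        (lqProblem A B U g Q S R).HorizonCondition C γ W Cbar δ N) ∧
    -- every horizon `T = N δ` that satisfies the horizon condition is stabilising on `K`
    (∀ C γ W Cbar, ∀ N : ℕ, 0 < C → (lqProblem A B U g Q S R).A2 γ W →
      (lqProblem A B U g Q S R).A3 (N * δ) C Cbar →
      K ⊆ (lqProblem A B U g Q S R).sublevel (N * δ) C →
      (lqProblem A B U g Q S R).HorizonCondition C γ W Cbar δ N →
      ∀ μ, (lqProblem A B U g Q S R).IsMPCFeedback (N * δ) μ →
        (lqProblem A B U g Q S R).IsAsymptoticallyStable (N * δ) δ μ ∧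
        K ⊆ (lqProblem A B U g Q S R).basin (N * δ) δ μ) := by
  obtain ⟨c₁, c₂, hP⟩ := isLinearQuadratic_lqProblem A B U g Q S R hU_convex hU_compact hU_zero
    hE_convex hE_compact hE_zero hcost
  obtain ⟨F, hF⟩ := hAB
  obtain ⟨κ, hκ, ω, hω, hG⟩ := hF.exists_norm_exp_smul_le
  have hAF : Matrix.toEuclideanCLM (n := Fin n) (𝕜 := ℝ) (A + B * F) =
      (Matrix.toEuclideanLin A).toContinuousLinearMap +
        (Matrix.toEuclideanLin B).toContinuousLinearMap ∘L
          (Matrix.toEuclideanLin F).toContinuousLinearMap := by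
    ext x i
    simp [Matrix.toLpLin_apply, Matrix.mulVec_mulVec]
  rw [hAF] at hG
  refine ⟨hP.a1, hP.exists_a2 hκ hω hG, fun T _ C _ => ?_,
    hP.exists_VInf_le_on_compact hκ hω hG hK hKA,
    fun C γ W _ hA2 => hP.exists_forall_horizonCondition hδ hA2,
    fun C γ W Cbar N hC hA2 hA3 hKC hH μ hμ => ?_⟩
  · obtain ⟨a, -, b, -, h⟩ := hP.exists_a3
    exact ⟨_, h T C⟩
  · obtain ⟨h1, h2⟩ := hP.isAsymptoticallyStable_of_horizonCondition hδ hC hA2 hA3 hH hμ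
    exact ⟨h1, hKC.trans h2⟩
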